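/- Let $(M,g)$ be a compact smooth Riemannian manifold (without boundary) of dimension $n\ge 3$. For a one-form $\theta$ with dual vector field $\xi=\theta^\sharp$ put $\delta^*\theta=\tfrac12 L_\xi g$; let $\delta$ denote the divergence, $(\delta\varphi)_j=-\nabla^i\varphi_{ij}$ on symmetric two-tensors and $\delta\theta=-\nabla^i\theta_i$ on one-forms; and let $\Delta_S=2\delta\delta^*-d\delta$ be the Sampson Laplacian on one-forms. Suppose that the Ricci tensor of $(M,g)$ has a York decomposition $$\mathrm{Ric}=(\delta^*\theta+\lambda g)+\varphi^{TT},$$ where $\theta$ is a smooth one-form, $\lambda\in C^\infty(M)$, and $\varphi^{TT}$ is a smooth symmetric two-tensor with $\delta\varphi^{TT}=0$ and $\operatorname{trace}_g\varphi^{TT}=0$. Then $$\Delta_S\theta=-(n-2)\,d\lambda .$$ Consequently, if $M$ is connected, $\lambda$ is constant if and only if $\xi=\theta^\sharp$ is an infinitesimal harmonic transformation, i.e. the local transformations $\Phi_t$ generated by $\xi$ ($\Phi_0=\mathrm{id}$, $\partial_t\Phi_t|_{t=0}=\xi$) are harmonic to first order in $t$: their tension fields satisfy $\frac{d}{dt}\big|_{t=0}\tau(\Phi_t)=0$.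 -/

import Mathlib

open Bundle Filter Topology
open scoped Manifold ContDiff

noncomputable section

namespace YorkRicci

/-! ## Tensor calculus in a coordinate domain

A tensor field on a coordinate domain of `ℝⁿ` is given by its component functions.  Throughout, `G`
denotes the components `g_{ij}` of a Riemannian metric. -/

/-- The model space `ℝⁿ`. -/
abbrev Coord (n : ℕ) : Type := EuclideanSpace ℝ (Fin n)

section Local

variable {n : ℕ}

/-- The `i`-th partial derivative `∂_i f`. -/
def pd (i : Fin n) (f : Coord n → ℝ) (y : Coord n) : ℝ :=
  fderiv ℝ f y (EuclideanSpace.single i 1)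

/-- The components `g^{ij}` of the inverse metric. -/
def ginv (G : Fin n → Fin n → Coord n → ℝ) (i j : Fin n) (y : Coord n) : ℝ :=
  (Matrix.of fun a b => G a b y)⁻¹ i j

/-- The Christoffel symbols `Γ^k_{ij} = ½ g^{kl} (∂_i g_{jl} + ∂_j g_{il} - ∂_l g_{ij})` of the
Levi-Civita connection. -/
def christoffel (G : Fin n → Fin n → Coord n → ℝ) (k i j : Fin n) (y : Coord n) : ℝ :=
  (1 / 2) * ∑ l, ginv G k l y * (pd i (G j l) y + pd j (G i l) y - pd l (G i j) y)

/-- The Ricci tensor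
`R_{ij} = ∂_k Γ^k_{ij} - ∂_j Γ^k_{ik} + Γ^k_{kl} Γ^l_{ij} - Γ^k_{jl} Γ^l_{ik}`
(positive on round spheres). -/
def ricci (G : Fin n → Fin n → Coord n → ℝ) (i j : Fin n) (y : Coord n) : ℝ :=
  ∑ k, (pd k (christoffel G k i j) y - pd j (christoffel G k i k) y
    + ∑ l, (christoffel G k k l y * christoffel G l i j y
        - christoffel G k j l y * christoffel G l i k y))

/-- The trace `g^{ij} φ_{ij}`. -/
def trace (G φ : Fin n → Fin n → Coord n → ℝ) (y : Coord n) : ℝ :=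
  ∑ i, ∑ j, ginv G i j y * φ i j y

/-- The codifferential `δθ = -g^{ij} ∇_i θ_j` of a one-form. -/
def codiff (G : Fin n → Fin n → Coord n → ℝ) (θ : Fin n → Coord n → ℝ) (y : Coord n) : ℝ :=
  -∑ i, ∑ j, ginv G i j y * (pd i (θ j) y - ∑ k, christoffel G k i j y * θ k y)

/-- The divergence `(δφ)_j = -g^{ik} ∇_i φ_{kj}` of a symmetric two-tensor, the formal adjoint of
`δ^*`. -/
def divergence (G φ : Fin n → Fin n → Coord n → ℝ) (j : Fin n) (y : Coord n) : ℝ :=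
  -∑ i, ∑ k, ginv G i k y * (pd i (φ k j) y
      - ∑ l, christoffel G l i k y * φ l j y - ∑ l, christoffel G l i j y * φ k l y)

/-- The components `θ^i = g^{ij} θ_j` of the vector field `θ^♯`. -/
def sharp (G : Fin n → Fin n → Coord n → ℝ) (θ : Fin n → Coord n → ℝ) (i : Fin n)
    (y : Coord n) : ℝ :=
  ∑ j, ginv G i j y * θ j y

/-- The Lie derivative of the metric,
`(L_ξ g)_{ij} = ξ^l ∂_l g_{ij} + g_{lj} ∂_i ξ^l + g_{il} ∂_j ξ^l`. -/
def lieMetric (G : Fin n → Fin n → Coord n → ℝ) (ξ : Fin n → Coord n → ℝ) (i j : Fin n)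
    (y : Coord n) : ℝ :=
  ∑ l, (ξ l y * pd l (G i j) y + G l j y * pd i (ξ l) y + G i l y * pd j (ξ l) y)

/-- The operator `δ^* θ = ½ L_{θ^♯} g`. -/
def deltaStar (G : Fin n → Fin n → Coord n → ℝ) (θ : Fin n → Coord n → ℝ) (i j : Fin n)
    (y : Coord n) : ℝ :=
  (1 / 2) * lieMetric G (sharp G θ) i j y

/-- The Sampson Laplacian `Δ_S = 2 δ δ^* - d δ` on one-forms. -/
def sampson (G : Fin n → Fin n → Coord n → ℝ) (θ : Fin n → Coord n → ℝ) (i : Fin n)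
    (y : Coord n) : ℝ :=
  2 * divergence G (deltaStar G θ) i y - pd i (codiff G θ) y

/-- The tension field of a map `f` from the coordinate domain to itself (both sides with the metric
`G`): `τ(f)^k = g^{ij} (∂_i ∂_j f^k - Γ^l_{ij} ∂_l f^k + Γ^k_{ab}(f) ∂_i f^a ∂_j f^b)`.  The map `f`
is harmonic if and only if `τ(f) = 0`. -/
def tension (G : Fin n → Fin n → Coord n → ℝ) (f : Coord n → Coord n) (k : Fin n)
    (y : Coord n) : ℝ :=
  ∑ i, ∑ j, ginv G i j y *
    (pd i (pd j fun z => f z k) y - ∑ l, christoffel G l i j y * pd l (fun z => f z k) y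
      + ∑ a, ∑ b, christoffel G k a b (f y) * pd i (fun z => f z a) y * pd j (fun z => f z b) y)

/-- `Φ` is, near `(0, y)`, a smooth one-parameter family of local transformations with `Φ_0 = id`
which is generated by the vector field `ξ`, i.e. with velocity `ξ` at time `0`.  The local
one-parameter group (flow) of `ξ` is such a family, and any other one agrees with it to first order
in `t`. -/
def IsLocalFamily (ξ : Fin n → Coord n → ℝ) (Φ : ℝ → Coord n → Coord n) (y : Coord n) : Prop :=
  ContDiffAt ℝ ∞ (fun p : ℝ × Coord n => Φ p.1 p.2) (0, y) ∧
  ∀ᶠ z in 𝓝 y, Φ 0 z = z ∧ ∀ k, HasDerivAt (fun t => Φ t z k) (ξ k z) 0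

end Local

/-! ## Tensor fields on a manifold -/

section Global

variable {n : ℕ} {M : Type*} [TopologicalSpace M] [ChartedSpace (Coord n) M]

/-- The coordinate vector field `∂_i` of the chart `e`, at the point with coordinates `y`. -/
def frame (e : OpenPartialHomeomorph M (Coord n)) (i : Fin n) (y : Coord n) :
    TangentSpace (𝓡 n) (e.symm y) :=
  mfderiv (𝓡 n) (𝓡 n) e.symm y (EuclideanSpace.single i (1 : ℝ) : Coord n)

/-- The components `ξ^i = dx^i(ξ)` of a vector field in the chart `e`. -/
def vecComp (e : OpenPartialHomeomorph M (Coord n)) (ξ : Π x : M, TangentSpace (𝓡 n) x)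
    (i : Fin n) (y : Coord n) : ℝ :=
  EuclideanSpace.proj (𝕜 := ℝ) i (mfderiv (𝓡 n) (𝓡 n) e (e.symm y) (ξ (e.symm y)))

/-- The components `θ_i = θ(∂_i)` of a one-form in the chart `e`. -/
def formComp (e : OpenPartialHomeomorph M (Coord n))
    (θ : Π x : M, TangentSpace (𝓡 n) x →L[ℝ] ℝ) (i : Fin n) (y : Coord n) : ℝ :=
  θ (e.symm y) (frame e i y)

/-- The components `φ_{ij} = φ(∂_i, ∂_j)` of a covariant two-tensor in the chart `e`. -/
def tensorComp (e : OpenPartialHomeomorph M (Coord n))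
    (φ : Π x : M, TangentSpace (𝓡 n) x →L[ℝ] TangentSpace (𝓡 n) x →L[ℝ] ℝ)
    (i j : Fin n) (y : Coord n) : ℝ :=
  φ (e.symm y) (frame e i y) (frame e j y)

variable (n M) in
/-- The smooth charts of the manifold. -/
abbrev charts [IsManifold (𝓡 n) ∞ M] : Set (OpenPartialHomeomorph M (Coord n)) :=
  IsManifold.maximalAtlas (𝓡 n) ∞ M

variable [IsManifold (𝓡 n) ∞ M]

variable (n M) in
/-- Smooth Riemannian metrics on `M`. -/
abbrev Metric : Type _ :=
  ContMDiffRiemannianMetric (𝓡 n) ∞ (Coord n) (fun x : M => TangentSpace (𝓡 n) x)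

variable (n M) in
/-- `C^∞(TM)`. -/
abbrev VectorField : Type _ :=
  ContMDiffSection (𝓡 n) (Coord n) ∞ (fun x : M => TangentSpace (𝓡 n) x)

variable (n M) in
/-- `C^∞(T^*M)`. -/
abbrev OneForm : Type _ :=
  ContMDiffSection (𝓡 n) (Coord n →L[ℝ] ℝ) ∞ (fun x : M => TangentSpace (𝓡 n) x →L[ℝ] ℝ)

variable (n M) in
/-- Smooth covariant two-tensors. -/
abbrev TwoTensor : Type _ :=
  ContMDiffSection (𝓡 n) (Coord n →L[ℝ] Coord n →L[ℝ] ℝ) ∞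
    (fun x : M => TangentSpace (𝓡 n) x →L[ℝ] TangentSpace (𝓡 n) x →L[ℝ] ℝ)

/-- `φ` is a TT-tensor: symmetric, divergence free and traceless. -/
structure IsTT (g : Metric n M) (φ : TwoTensor n M) : Prop where
  symm : ∀ (x : M) (v w : TangentSpace (𝓡 n) x), φ x v w = φ x w v
  divergence_eq_zero : ∀ e ∈ charts n M, ∀ y ∈ e.target, ∀ j,
    divergence (tensorComp e g.inner) (tensorComp e φ) j y = 0
  trace_eq_zero : ∀ e ∈ charts n M, ∀ y ∈ e.target,
    trace (tensorComp e g.inner) (tensorComp e φ) y = 0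

/-- `Ric = (δ^* θ + lam g) + φ` with a TT-tensor `φ`: a York decomposition of the Ricci tensor.
The identity of tensors is expressed by their components in every smooth chart. -/
structure IsYorkDecompositionRic (g : Metric n M) (θ : OneForm n M) (lam : C^∞⟮𝓡 n, M; ℝ⟯)
    (φ : TwoTensor n M) : Prop where
  isTT : IsTT g φ
  ricci_eq : ∀ e ∈ charts n M, ∀ y ∈ e.target, ∀ i j,
    ricci (tensorComp e g.inner) i j y =
      (deltaStar (tensorComp e g.inner) (formComp e θ) i j y
        + lam (e.symm y) * tensorComp e g.inner i j y) + tensorComp e φ i j y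

/-- `ξ` is an infinitesimal harmonic transformation: the transformations generated by `ξ` are
harmonic to first order, `d/dt τ(Φ_t) = 0` at `t = 0`. -/
def IsInfinitesimalHarmonic (g : Metric n M) (ξ : VectorField n M) : Prop :=
  ∀ e ∈ charts n M, ∀ y ∈ e.target, ∀ Φ : ℝ → Coord n → Coord n,
    IsLocalFamily (vecComp e ξ) Φ y →
      ∀ k, HasDerivAt (fun t => tension (tensorComp e g.inner) (Φ t) k y) 0 0

end Global

end YorkRicci

end

namespace YorkRicci

/-! ## Directional and partial derivatives -/

section Calculus

variable {n : ℕ} {U : Set (Coord n)} {f f' : Coord n → ℝ} {y : Coord n}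

/-! The formula comes from the contracted Bianchi identity. Since `δ(λg) = -dλ` and `φ` is
divergence free, `δRic = δδ^*θ - dλ`. Since `trace δ^*θ = -δθ` and `φ` is traceless, the scalar
curvature is `s = nλ - δθ`. Substituting both into `2δRic = -ds` gives `2δδ^*θ - dδθ = -(n-2)dλ`.
This is `sampson_of_york`, resting on `contracted_bianchi`.

For the equivalence, `Δ_S θ` and the first variation of the tension field are the same object up to
sign and lowering an index: the metric trace `g^{ij}(L_ξ Γ)^k_{ij}`. On one side `sampson_eq`
follows from `cov_lieMetric`, which writes `∇_i(g⁻¹ L_ξ g)` as `(L_ξ Γ)_i` plus its `g`-adjoint. On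
the other side `hasDerivAt_tension` differentiates `τ(Φ_t)` at the identity. So `ξ` is infinitesimal
harmonic exactly when `Δ_S θ = 0`, that is, as `n > 2`, when `dλ = 0`.

Everything is computed in one chart at a time. The Christoffel symbols are packed into matrices
`A_i`, so that the tensor identities become noncommutative algebra of `A_i`, `g`, `g⁻¹` and their
entrywise derivatives. -/

theorem pd_congr (hU : IsOpen U) (h : ∀ z ∈ U, f z = f' z) (hy : y ∈ U) (i : Fin n) :
    pd i f y = pd i f' y := by
  have : f =ᶠ[𝓝 y] f' := by
    filter_upwards [hU.mem_nhds hy] with z hz using h z hz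
  simp only [pd, this.fderiv_eq]

theorem differentiableAt_of_smooth (hU : IsOpen U) (hf : ContDiffOn ℝ ∞ f U) (hy : y ∈ U) :
    DifferentiableAt ℝ f y :=
  (hf.contDiffAt (hU.mem_nhds hy)).differentiableAt (by simp)

theorem contDiffOn_pd (hU : IsOpen U) (hf : ContDiffOn ℝ ∞ f U) (i : Fin n) :
    ContDiffOn ℝ ∞ (pd i f) U :=
  (hf.fderiv_of_isOpen hU (by simp)).clm_apply contDiffOn_const

@[simp]
theorem pd_const (c : ℝ) (i : Fin n) : pd i (fun _ => c) y = 0 := by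
  simp [pd]

theorem pd_add (hU : IsOpen U) (hf : ContDiffOn ℝ ∞ f U) (hf' : ContDiffOn ℝ ∞ f' U)
    (hy : y ∈ U) (i : Fin n) : pd i (fun z => f z + f' z) y = pd i f y + pd i f' y := by
  simp only [pd]
  rw [fderiv_fun_add (differentiableAt_of_smooth hU hf hy) (differentiableAt_of_smooth hU hf' hy)]
  simp

theorem pd_sub (hU : IsOpen U) (hf : ContDiffOn ℝ ∞ f U) (hf' : ContDiffOn ℝ ∞ f' U)
    (hy : y ∈ U) (i : Fin n) : pd i (fun z => f z - f' z) y = pd i f y - pd i f' y := by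
  simp only [pd]
  rw [fderiv_fun_sub (differentiableAt_of_smooth hU hf hy) (differentiableAt_of_smooth hU hf' hy)]
  simp

theorem pd_neg (i : Fin n) : pd i (fun z => -f z) y = -pd i f y := by
  simp [pd, fderiv_fun_neg]

theorem pd_mul (hU : IsOpen U) (hf : ContDiffOn ℝ ∞ f U) (hf' : ContDiffOn ℝ ∞ f' U)
    (hy : y ∈ U) (i : Fin n) :
    pd i (fun z => f z * f' z) y = pd i f y * f' y + f y * pd i f' y := by
  simp only [pd]
  rw [fderiv_fun_mul (differentiableAt_of_smooth hU hf hy) (differentiableAt_of_smooth hU hf' hy)]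
  simp; ring

theorem pd_sum {ι : Type*} (s : Finset ι) {F : ι → Coord n → ℝ} (hU : IsOpen U)
    (hF : ∀ a ∈ s, ContDiffOn ℝ ∞ (F a) U) (hy : y ∈ U) (i : Fin n) :
    pd i (fun z => ∑ a ∈ s, F a z) y = ∑ a ∈ s, pd i (F a) y := by
  simp only [pd]
  rw [fderiv_fun_sum fun a ha => differentiableAt_of_smooth hU (hF a ha) hy]
  simp

theorem pd_comm (hU : IsOpen U) (hf : ContDiffOn ℝ ∞ f U) (hy : y ∈ U) (i j : Fin n) :
    pd i (pd j f) y = pd j (pd i f) y := by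
  have hd : DifferentiableAt ℝ (fderiv ℝ f) y :=
    (((hf.fderiv_of_isOpen hU (m := ∞) (by simp)).contDiffAt
      (hU.mem_nhds hy))).differentiableAt (by simp)
  have hs : IsSymmSndFDerivAt ℝ f y :=
    (hf.contDiffAt (hU.mem_nhds hy)).isSymmSndFDerivAt (by
      simp only [minSmoothness_of_isRCLikeNormedField]
      exact WithTop.coe_le_coe.2 (le_top : (2 : ℕ∞) ≤ ⊤))
  have key : ∀ a b : Fin n, pd a (pd b f) y =
      fderiv ℝ (fderiv ℝ f) y (EuclideanSpace.single a 1) (EuclideanSpace.single b 1) := by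
    intro a b
    change fderiv ℝ (fun z => fderiv ℝ f z (EuclideanSpace.single b 1)) y _ = _
    rw [fderiv_clm_apply hd (differentiableAt_const _)]
    simp
  rw [key, key, hs.eq]

end Calculus

/-! ## Matrix fields -/

section MatrixFields

variable {n : ℕ}

/-- Matrix-valued functions on `ℝⁿ`. -/
abbrev MatField (n : ℕ) : Type := Coord n → Matrix (Fin n) (Fin n) ℝ

/-- The entrywise partial derivative of a matrix field. -/
noncomputable def mpd (i : Fin n) (X : MatField n) : MatField n :=
  fun y => Matrix.of fun a b => pd i (fun z => X z a b) y

/-- Entrywise smoothness of a matrix field. -/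
def MatSmooth (U : Set (Coord n)) (X : MatField n) : Prop :=
  ∀ a b, ContDiffOn ℝ ∞ (fun z => X z a b) U

variable {U : Set (Coord n)} {X Y : MatField n} {y : Coord n}

theorem mpd_apply (i a b : Fin n) : mpd i X y a b = pd i (fun z => X z a b) y := rfl

theorem MatSmooth.add (hX : MatSmooth U X) (hY : MatSmooth U Y) : MatSmooth U (X + Y) :=
  fun a b => (hX a b).add (hY a b)

theorem MatSmooth.sub (hX : MatSmooth U X) (hY : MatSmooth U Y) : MatSmooth U (X - Y) :=
  fun a b => (hX a b).sub (hY a b)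

theorem MatSmooth.smul {c : Coord n → ℝ} (hc : ContDiffOn ℝ ∞ c U) (hX : MatSmooth U X) :
    MatSmooth U (fun z => c z • X z) :=
  fun a b => hc.mul (hX a b)

theorem MatSmooth.mul (hX : MatSmooth U X) (hY : MatSmooth U Y) : MatSmooth U (X * Y) := by
  intro a b
  simp only [Pi.mul_apply, Matrix.mul_apply]
  exact ContDiffOn.sum fun c _ => (hX a c).mul (hY c b)

theorem MatSmooth.sum {ι : Type*} (s : Finset ι) {F : ι → MatField n}
    (hF : ∀ a ∈ s, MatSmooth U (F a)) : MatSmooth U (fun z => ∑ a ∈ s, F a z) := by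
  intro a b
  simp only [Matrix.sum_apply]
  exact ContDiffOn.sum fun c hc => hF c hc a b

theorem MatSmooth.transpose (hX : MatSmooth U X) : MatSmooth U (fun z => (X z).transpose) :=
  fun a b => hX b a

theorem MatSmooth.mpd (hU : IsOpen U) (hX : MatSmooth U X) (i : Fin n) :
    MatSmooth U (mpd i X) :=
  fun a b => contDiffOn_pd hU (hX a b) i

theorem MatSmooth.congr (hX : MatSmooth U X) (h : ∀ z ∈ U, Y z = X z) : MatSmooth U Y :=
  fun a b => (hX a b).congr fun z hz => by rw [h z hz]

theorem mpd_congr (hU : IsOpen U) (h : ∀ z ∈ U, X z = Y z) (hy : y ∈ U) (i : Fin n) :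
    mpd i X y = mpd i Y y := by
  ext a b
  exact pd_congr hU (fun z hz => by rw [h z hz]) hy i

theorem mpd_add (hU : IsOpen U) (hX : MatSmooth U X) (hY : MatSmooth U Y) (hy : y ∈ U)
    (i : Fin n) : mpd i (X + Y) y = mpd i X y + mpd i Y y := by
  ext a b
  exact pd_add hU (hX a b) (hY a b) hy i

theorem mpd_sub (hU : IsOpen U) (hX : MatSmooth U X) (hY : MatSmooth U Y) (hy : y ∈ U)
    (i : Fin n) : mpd i (X - Y) y = mpd i X y - mpd i Y y := by
  ext a b
  exact pd_sub hU (hX a b) (hY a b) hy i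

theorem mpd_neg (i : Fin n) : mpd i (-X) y = -mpd i X y := by
  ext a b
  exact pd_neg i

theorem mpd_mul (hU : IsOpen U) (hX : MatSmooth U X) (hY : MatSmooth U Y) (hy : y ∈ U)
    (i : Fin n) : mpd i (X * Y) y = mpd i X y * Y y + X y * mpd i Y y := by
  ext a b
  simp only [Matrix.add_apply, Matrix.mul_apply, mpd_apply, Pi.mul_apply]
  rw [pd_sum _ hU (fun c _ => (hX a c).mul (hY c b)) hy, ← Finset.sum_add_distrib]
  exact Finset.sum_congr rfl fun c _ => pd_mul hU (hX a c) (hY c b) hy i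

theorem mpd_smul {c : Coord n → ℝ} (hU : IsOpen U) (hc : ContDiffOn ℝ ∞ c U)
    (hX : MatSmooth U X) (hy : y ∈ U) (i : Fin n) :
    mpd i (fun z => c z • X z) y = pd i c y • X y + c y • mpd i X y := by
  ext a b
  exact pd_mul hU hc (hX a b) hy i

theorem mpd_sum {ι : Type*} (s : Finset ι) {F : ι → MatField n} (hU : IsOpen U)
    (hF : ∀ a ∈ s, MatSmooth U (F a)) (hy : y ∈ U) (i : Fin n) :
    mpd i (fun z => ∑ a ∈ s, F a z) y = ∑ a ∈ s, mpd i (F a) y := by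
  ext a b
  simp only [Matrix.sum_apply, mpd_apply]
  exact pd_sum _ hU (fun c hc => hF c hc a b) hy i

theorem mpd_comm (hU : IsOpen U) (hX : MatSmooth U X) (hy : y ∈ U) (i j : Fin n) :
    mpd i (mpd j X) y = mpd j (mpd i X) y := by
  ext a b
  exact pd_comm hU (hX a b) hy i j

theorem pd_trace (hU : IsOpen U) (hX : MatSmooth U X) (hy : y ∈ U) (i : Fin n) :
    pd i (fun z => (X z).trace) y = (mpd i X y).trace := by
  simp only [Matrix.trace, Matrix.diag_apply]
  exact pd_sum _ hU (fun c _ => hX c c) hy i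

theorem MatSmooth.trace (hX : MatSmooth U X) : ContDiffOn ℝ ∞ (fun z => (X z).trace) U :=
  ContDiffOn.sum fun a _ => hX a a

theorem MatSmooth.det (hX : MatSmooth U X) : ContDiffOn ℝ ∞ (fun z => (X z).det) U := by
  simp only [Matrix.det_apply, Units.smul_def, zsmul_eq_mul]
  exact ContDiffOn.sum fun σ _ => contDiffOn_const.mul (contDiffOn_prod fun c _ => hX _ _)

/-- Cramer's rule: an entry of the adjugate is the determinant of the matrix with one row replaced
by a constant one. -/
theorem MatSmooth.inv (hX : MatSmooth U X) (h : ∀ z ∈ U, (X z).det ≠ 0) :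
    MatSmooth U (fun z => (X z)⁻¹) := by
  intro a b
  have hadj : ContDiffOn ℝ ∞ (fun z => (X z).adjugate a b) U := by
    simp only [Matrix.adjugate_apply]
    refine MatSmooth.det (X := fun z => (X z).updateRow b (Pi.single a 1)) fun c d => ?_
    simp only [Matrix.updateRow_apply]
    split_ifs
    · exact contDiffOn_const
    · exact hX c d
  simp only [Matrix.inv_def, Ring.inverse_eq_inv', Matrix.smul_apply, smul_eq_mul]
  exact (hX.det.inv h).mul hadj

end MatrixFields

/-! ## Matrix form of Riemannian geometry in a coordinate domain -/

section Geometry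

open Matrix

variable {n : ℕ} {U : Set (Coord n)} {G : Fin n → Fin n → Coord n → ℝ} {y : Coord n}

/-- `G` gives the components of a smooth nondegenerate symmetric two-tensor on the open set `U`. -/
structure IsMetricOn (U : Set (Coord n)) (G : Fin n → Fin n → Coord n → ℝ) : Prop where
  isOpen : IsOpen U
  smooth : ∀ i j, ContDiffOn ℝ ∞ (G i j) U
  symm : ∀ z ∈ U, ∀ i j, G i j z = G j i z
  det_ne_zero : ∀ z ∈ U, (Matrix.of fun a b => G a b z).det ≠ 0

/-- The matrix field with the given component functions. -/
def compMat (φ : Fin n → Fin n → Coord n → ℝ) : MatField n :=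
  fun z => Matrix.of fun a b => φ a b z

/-- The matrix field `g^{ij}`. -/
noncomputable def invMat (G : Fin n → Fin n → Coord n → ℝ) : MatField n :=
  fun z => (compMat G z)⁻¹

/-- The connection matrix `(A_i)^l_k = Γ^l_{ik}`. -/
noncomputable def connMat (G : Fin n → Fin n → Coord n → ℝ) (i : Fin n) : MatField n :=
  fun z => Matrix.of fun l k => christoffel G l i k z

/-- The transposed connection matrix. -/
noncomputable def connMatT (G : Fin n → Fin n → Coord n → ℝ) (i : Fin n) : MatField n :=
  fun z => (connMat G i z)ᵀ

/-- The curvature `F_{ij} = ∂_i A_j - ∂_j A_i + [A_i, A_j]`. -/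
noncomputable def curvMat (G : Fin n → Fin n → Coord n → ℝ) (i j : Fin n) : MatField n :=
  mpd i (connMat G j) - mpd j (connMat G i) + connMat G i * connMat G j
    - connMat G j * connMat G i

/-- The curvature with its second index raised. -/
noncomputable def curvUp (G : Fin n → Fin n → Coord n → ℝ) (i j : Fin n) : MatField n :=
  curvMat G i j * invMat G

/-- The covariant derivative `∇_i V = ∂_i V + [A_i, V]` of a field of endomorphisms, leaving the
index `i` uncorrected. -/
noncomputable def cov (G : Fin n → Fin n → Coord n → ℝ) (i : Fin n) (V : MatField n) :
    MatField n :=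
  mpd i V + connMat G i * V - V * connMat G i

namespace IsMetricOn

theorem compMat_transpose (hG : IsMetricOn U G) (hy : y ∈ U) : (compMat G y)ᵀ = compMat G y := by
  ext a b
  exact hG.symm y hy b a

theorem mul_inv (hG : IsMetricOn U G) (hy : y ∈ U) : compMat G y * invMat G y = 1 :=
  Matrix.mul_nonsing_inv _ (hG.det_ne_zero y hy).isUnit

theorem inv_mul (hG : IsMetricOn U G) (hy : y ∈ U) : invMat G y * compMat G y = 1 :=
  Matrix.nonsing_inv_mul _ (hG.det_ne_zero y hy).isUnit

theorem invMat_transpose (hG : IsMetricOn U G) (hy : y ∈ U) : (invMat G y)ᵀ = invMat G y := by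
  rw [invMat, Matrix.transpose_nonsing_inv, hG.compMat_transpose hy]

theorem smooth_compMat (hG : IsMetricOn U G) : MatSmooth U (compMat G) := hG.smooth

theorem smooth_invMat (hG : IsMetricOn U G) : MatSmooth U (invMat G) :=
  hG.smooth_compMat.inv hG.det_ne_zero

theorem smooth_ginv (hG : IsMetricOn U G) (i j : Fin n) : ContDiffOn ℝ ∞ (ginv G i j) U :=
  hG.smooth_invMat i j

theorem smooth_christoffel (hG : IsMetricOn U G) (k i j : Fin n) :
    ContDiffOn ℝ ∞ (christoffel G k i j) U := by
  refine contDiffOn_const.mul (ContDiffOn.sum fun l _ => (hG.smooth_ginv k l).mul ?_)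
  exact ((contDiffOn_pd hG.isOpen (hG.smooth _ _) _).add
    (contDiffOn_pd hG.isOpen (hG.smooth _ _) _)).sub (contDiffOn_pd hG.isOpen (hG.smooth _ _) _)

theorem smooth_connMat (hG : IsMetricOn U G) (i : Fin n) : MatSmooth U (connMat G i) :=
  fun l k => hG.smooth_christoffel l i k

theorem smooth_connMatT (hG : IsMetricOn U G) (i : Fin n) : MatSmooth U (connMatT G i) :=
  fun l k => hG.smooth_christoffel k i l

theorem smooth_curvMat (hG : IsMetricOn U G) (i j : Fin n) : MatSmooth U (curvMat G i j) :=
  ((((hG.smooth_connMat j).mpd hG.isOpen i).sub ((hG.smooth_connMat i).mpd hG.isOpen j)).add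
    ((hG.smooth_connMat i).mul (hG.smooth_connMat j))).sub
    ((hG.smooth_connMat j).mul (hG.smooth_connMat i))

theorem smooth_curvUp (hG : IsMetricOn U G) (i j : Fin n) : MatSmooth U (curvUp G i j) :=
  (hG.smooth_curvMat i j).mul hG.smooth_invMat

theorem pd_symm (hG : IsMetricOn U G) (hy : y ∈ U) (l i j : Fin n) :
    pd l (G i j) y = pd l (G j i) y :=
  pd_congr hG.isOpen (fun z hz => hG.symm z hz i j) hy l

theorem christoffel_symm (hG : IsMetricOn U G) (hy : y ∈ U) (k i j : Fin n) :
    christoffel G k i j y = christoffel G k j i y := by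
  simp only [christoffel]
  congr 1
  refine Finset.sum_congr rfl fun l _ => ?_
  rw [hG.pd_symm hy l i j]
  ring

/-- The inverse metric in the definition of `Γ` cancels against `g`. The right side is the
Christoffel symbol of the first kind, from which metric compatibility can be read off. -/
theorem christoffel_lower (hG : IsMetricOn U G) (hy : y ∈ U) (a i b : Fin n) :
    ∑ l, G a l y * christoffel G l i b y =
      (1 / 2) * (pd i (G b a) y + pd b (G i a) y - pd a (G i b) y) := by
  set v : Fin n → ℝ := fun m => (1 / 2) * (pd i (G b m) y + pd b (G i m) y - pd m (G i b) y)
    with hv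
  have h1 : (fun l => christoffel G l i b y) = invMat G y *ᵥ v := by
    funext l
    simp only [christoffel, Matrix.mulVec, dotProduct, hv, Finset.mul_sum]
    exact Finset.sum_congr rfl fun m _ => by rw [show invMat G y l m = ginv G l m y from rfl]; ring
  have h2 : compMat G y *ᵥ (fun l => christoffel G l i b y) = v := by
    rw [h1, Matrix.mulVec_mulVec, hG.mul_inv hy, Matrix.one_mulVec]
  exact congrFun h2 a

/-- Metric compatibility `∂_i g = g A_i + A_iᵀ g`. -/
theorem mpd_metric (hG : IsMetricOn U G) (hy : y ∈ U) (i : Fin n) :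
    mpd i (compMat G) y = compMat G y * connMat G i y + connMatT G i y * compMat G y := by
  ext a b
  have h1 := hG.christoffel_lower hy a i b
  have h2 := hG.christoffel_lower hy b i a
  have h3 : ∑ l, christoffel G l i a y * G l b y = ∑ l, G b l y * christoffel G l i a y :=
    Finset.sum_congr rfl fun l _ => by rw [hG.symm y hy l b, mul_comm]
  change pd i (G a b) y = ∑ l, G a l y * christoffel G l i b y
    + ∑ l, christoffel G l i a y * G l b y
  rw [h3, h1, h2, hG.pd_symm hy i b a, hG.pd_symm hy b i a, hG.pd_symm hy a i b]
  ring

/-- `∂_i g⁻¹ = -(A_i g⁻¹ + g⁻¹ A_iᵀ)`. -/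
theorem mpd_invMat (hG : IsMetricOn U G) (hy : y ∈ U) (i : Fin n) :
    mpd i (invMat G) y = -(connMat G i y * invMat G y + invMat G y * connMatT G i y) := by
  -- Differentiate `g g⁻¹ = 1`, then multiply on the left by `g⁻¹`.
  have h0 : mpd i (compMat G * invMat G) y = 0 := by
    rw [mpd_congr hG.isOpen (X := compMat G * invMat G) (Y := fun _ => 1) (fun z hz => hG.mul_inv hz) hy]
    ext a b
    simp [mpd_apply]
  rw [mpd_mul hG.isOpen hG.smooth_compMat hG.smooth_invMat hy, hG.mpd_metric hy] at h0
  have h1 := congrArg (invMat G y * ·) h0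
  simp only [mul_zero, mul_add, add_mul, ← mul_assoc, hG.inv_mul hy, one_mul] at h1
  rw [mul_assoc (invMat G y * connMatT G i y), hG.mul_inv hy, mul_one] at h1
  exact eq_neg_of_add_eq_zero_right h1

theorem mpd_mpd_invMat (hG : IsMetricOn U G) (hy : y ∈ U) (i j : Fin n) :
    mpd i (mpd j (invMat G)) y =
      -(mpd i (connMat G j) y * invMat G y
        - connMat G j y * (connMat G i y * invMat G y + invMat G y * connMatT G i y)
        - (connMat G i y * invMat G y + invMat G y * connMatT G i y) * connMatT G j y
        + invMat G y * (mpd i (connMat G j) y)ᵀ) := by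
  have hU := hG.isOpen
  rw [mpd_congr hU (Y := -(connMat G j * invMat G + invMat G * connMatT G j))
      (fun z hz => hG.mpd_invMat hz j) hy, mpd_neg,
    mpd_add hU ((hG.smooth_connMat j).mul hG.smooth_invMat)
      (hG.smooth_invMat.mul (hG.smooth_connMatT j)) hy,
    mpd_mul hU (hG.smooth_connMat j) hG.smooth_invMat hy,
    mpd_mul hU hG.smooth_invMat (hG.smooth_connMatT j) hy, hG.mpd_invMat hy i,
    show mpd i (connMatT G j) y = (mpd i (connMat G j) y)ᵀ from rfl]
  noncomm_ring

/-- Antisymmetrising `∂_i ∂_j g⁻¹` in `i, j` gives `-(F_{ij} g⁻¹ + g⁻¹ F_{ij}ᵀ)`, which vanishes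
because partial derivatives commute. -/
theorem curvUp_transpose (hG : IsMetricOn U G) (hy : y ∈ U) (i j : Fin n) :
    (curvUp G i j y)ᵀ = -curvUp G i j y := by
  have h := mpd_comm hG.isOpen hG.smooth_invMat hy i j
  rw [hG.mpd_mpd_invMat hy, hG.mpd_mpd_invMat hy] at h
  simp only [curvUp, curvMat, Pi.mul_apply, Pi.add_apply, Pi.sub_apply, Matrix.transpose_mul,
    Matrix.transpose_add, Matrix.transpose_sub, hG.invMat_transpose hy]
  simp only [connMatT] at h ⊢
  linear_combination (norm := noncomm_ring) -h

theorem curvUp_swap (i j : Fin n) : curvUp G j i y = -curvUp G i j y := by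
  simp only [curvUp, curvMat, Pi.mul_apply, Pi.add_apply, Pi.sub_apply]
  noncomm_ring

theorem curvUp_antisymm (hG : IsMetricOn U G) (hy : y ∈ U) (i j a b : Fin n) :
    curvUp G i j y b a = -curvUp G i j y a b :=
  congrFun (congrFun (hG.curvUp_transpose hy i j) a) b

theorem mpd_curvMat (hG : IsMetricOn U G) (hy : y ∈ U) (m i j : Fin n) :
    mpd m (curvMat G i j) y = mpd m (mpd i (connMat G j)) y - mpd m (mpd j (connMat G i)) y
      + (mpd m (connMat G i) y * connMat G j y + connMat G i y * mpd m (connMat G j) y)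
      - (mpd m (connMat G j) y * connMat G i y + connMat G j y * mpd m (connMat G i) y) := by
  have hU := hG.isOpen
  have hA := hG.smooth_connMat
  rw [curvMat, mpd_sub hU ((((hA j).mpd hU i).sub ((hA i).mpd hU j)).add ((hA i).mul (hA j)))
      ((hA j).mul (hA i)) hy, mpd_add hU (((hA j).mpd hU i).sub ((hA i).mpd hU j))
      ((hA i).mul (hA j)) hy, mpd_sub hU ((hA j).mpd hU i) ((hA i).mpd hU j) hy,
    mpd_mul hU (hA i) (hA j) hy, mpd_mul hU (hA j) (hA i) hy]

/-- The second Bianchi identity. -/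
theorem bianchi_curvMat (hG : IsMetricOn U G) (hy : y ∈ U) (m i j : Fin n) :
    cov G m (curvMat G i j) y + cov G i (curvMat G j m) y + cov G j (curvMat G m i) y = 0 := by
  have hU := hG.isOpen
  have hA := hG.smooth_connMat
  simp only [cov, Pi.add_apply, Pi.sub_apply, Pi.mul_apply]
  rw [hG.mpd_curvMat hy, hG.mpd_curvMat hy, hG.mpd_curvMat hy,
    mpd_comm hU (hA j) hy m i, mpd_comm hU (hA i) hy m j, mpd_comm hU (hA m) hy i j]
  simp only [curvMat, Pi.add_apply, Pi.sub_apply, Pi.mul_apply]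
  noncomm_ring

/-- The inverse metric is parallel, so raising an index commutes with covariant differentiation. The
raised index is then corrected by the transposed connection matrix. -/
theorem cov_curvMat_mul_inv (hG : IsMetricOn U G) (hy : y ∈ U) (m i j : Fin n) :
    cov G m (curvMat G i j) y * invMat G y =
      mpd m (curvUp G i j) y + connMat G m y * curvUp G i j y
        + curvUp G i j y * connMatT G m y := by
  rw [curvUp, mpd_mul hG.isOpen (hG.smooth_curvMat i j) hG.smooth_invMat hy, hG.mpd_invMat hy]
  simp only [cov, Pi.add_apply, Pi.sub_apply, Pi.mul_apply]
  noncomm_ring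

theorem bianchi_curvUp (hG : IsMetricOn U G) (hy : y ∈ U) (m i j : Fin n) :
    (mpd m (curvUp G i j) y + connMat G m y * curvUp G i j y + curvUp G i j y * connMatT G m y)
    + (mpd i (curvUp G j m) y + connMat G i y * curvUp G j m y + curvUp G j m y * connMatT G i y)
    + (mpd j (curvUp G m i) y + connMat G j y * curvUp G m i y + curvUp G m i y * connMatT G j y)
      = 0 := by
  rw [← hG.cov_curvMat_mul_inv hy, ← hG.cov_curvMat_mul_inv hy, ← hG.cov_curvMat_mul_inv hy,
    ← add_mul, ← add_mul, hG.bianchi_curvMat hy, zero_mul]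

end IsMetricOn

end Geometry

/-! ## The contracted Bianchi identity and the Sampson Laplacian -/

section Contraction

open Matrix

variable {n : ℕ} {U : Set (Coord n)} {G : Fin n → Fin n → Coord n → ℝ} {y : Coord n}

/-- Serves to discard contractions of torsion-free Christoffel symbols with the curvature. -/
theorem sum_symm_mul_antisymm {S N : Fin n → Fin n → ℝ} (hS : ∀ a b, S a b = S b a)
    (hN : ∀ a b, N a b = -N b a) : ∑ a, ∑ b, S a b * N b a = 0 := by
  have h : ∑ a, ∑ b, S a b * N b a = -∑ a, ∑ b, S a b * N b a := by
    conv_lhs => rw [Finset.sum_comm]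
    simp only [← Finset.sum_neg_distrib]
    refine Finset.sum_congr rfl fun a _ => Finset.sum_congr rfl fun b _ => ?_
    rw [hS b a, hN a b]
    ring
  linarith

/-- The Ricci tensor with its first index raised. -/
noncomputable def ricUp (G : Fin n → Fin n → Coord n → ℝ) : MatField n :=
  invMat G * compMat (ricci G)

namespace IsMetricOn

/-- The two sides order the lower indices of `Γ` differently; absence of torsion reconciles them. -/
theorem ricci_eq_curvMat (hG : IsMetricOn U G) (hy : y ∈ U) (k j : Fin n) :
    ricci G k j y = ∑ i, curvMat G i j y i k := by
  refine Finset.sum_congr rfl fun i _ => ?_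
  have h1 : pd i (christoffel G i k j) y = pd i (christoffel G i j k) y :=
    pd_congr hG.isOpen (fun z hz => hG.christoffel_symm hz i k j) hy i
  have h2 : pd j (christoffel G i k i) y = pd j (christoffel G i i k) y :=
    pd_congr hG.isOpen (fun z hz => hG.christoffel_symm hz i k i) hy j
  have h3 : curvMat G i j y i k = pd i (christoffel G i j k) y - pd j (christoffel G i i k) y
      + ∑ l, christoffel G i i l y * christoffel G l j k y
      - ∑ l, christoffel G i j l y * christoffel G l i k y := rfl
  rw [h1, h2, h3, add_sub_assoc, ← Finset.sum_sub_distrib]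
  congr 1
  refine Finset.sum_congr rfl fun l _ => ?_
  rw [hG.christoffel_symm hy l k j, hG.christoffel_symm hy l k i]

theorem smooth_ricci (hG : IsMetricOn U G) : MatSmooth U (compMat (ricci G)) := by
  intro k j
  refine ContDiffOn.congr (f := fun z => ∑ i, curvMat G i j z i k)
    (ContDiffOn.sum fun i _ => hG.smooth_curvMat i j i k) fun z hz => ?_
  exact hG.ricci_eq_curvMat hz k j

theorem smooth_ricUp (hG : IsMetricOn U G) : MatSmooth U (ricUp G) :=
  hG.smooth_invMat.mul hG.smooth_ricci

theorem ricUp_apply (hG : IsMetricOn U G) (hy : y ∈ U) (k j : Fin n) :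
    ricUp G y k j = ∑ i, curvUp G i j y i k := by
  simp only [ricUp, curvUp, Pi.mul_apply, Matrix.mul_apply]
  rw [Finset.sum_comm]
  refine Finset.sum_congr rfl fun l _ => ?_
  rw [show compMat (ricci G) y l j = ricci G l j y from rfl, hG.ricci_eq_curvMat hy,
    Finset.mul_sum]
  refine Finset.sum_congr rfl fun i _ => ?_
  rw [← congrFun (congrFun (hG.invMat_transpose hy) k) l, Matrix.transpose_apply, mul_comm]

theorem mpd_ricUp_apply (hG : IsMetricOn U G) (hy : y ∈ U) (m k j : Fin n) :
    mpd m (ricUp G) y k j = ∑ i, mpd m (curvUp G i j) y i k := by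
  rw [mpd_apply, pd_congr hG.isOpen (fun z hz => hG.ricUp_apply hz k j) hy]
  exact pd_sum _ hG.isOpen (fun i _ => hG.smooth_curvUp i j i k) hy m

theorem mpd_curvUp_antisymm (hG : IsMetricOn U G) (hy : y ∈ U) (m i j a b : Fin n) :
    mpd m (curvUp G i j) y b a = -mpd m (curvUp G i j) y a b := by
  rw [mpd_apply, pd_congr hG.isOpen (fun z hz => hG.curvUp_antisymm hz i j a b) hy, pd_neg]
  rfl

theorem mpd_curvUp_swap (m i j a b : Fin n) :
    mpd m (curvUp G j i) y a b = -mpd m (curvUp G i j) y a b := by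
  rw [show curvUp G j i = -curvUp G i j from funext fun z => curvUp_swap i j, mpd_neg]
  rfl

theorem connMat_symm (hG : IsMetricOn U G) (hy : y ∈ U) (l i k : Fin n) :
    connMat G i y l k = connMat G k y l i :=
  hG.christoffel_symm hy l i k

/-- The contracted second Bianchi identity `2 ∇^m R_{mj} = ∂_j s`. -/
theorem contracted_bianchi (hG : IsMetricOn U G) (hy : y ∈ U) (j : Fin n) :
    2 * ∑ m, cov G m (ricUp G) y m j = pd j (fun z => (ricUp G z).trace) y := by
  have hanti := hG.curvUp_antisymm hy
  have hswap : ∀ i j a b, curvUp G j i y a b = -curvUp G i j y a b :=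
    fun i j a b => congrFun (congrFun (curvUp_swap i j) a) b
  -- Contract the Bianchi identity over `i` and `m`. Of the nine resulting sums, the first two
  -- groups each give the divergence of Ricci without its last correction, and the third gives `-∂_j
  -- s` together with twice that correction. The remaining sums `s1b` and `s2c` pair `Γ`, symmetric
  -- in its lower indices, with the antisymmetric curvature and vanish.
  have hsum : ∑ i, ∑ m, ((mpd m (curvUp G i j) y + connMat G m y * curvUp G i j y
        + curvUp G i j y * connMatT G m y)
      + (mpd i (curvUp G j m) y + connMat G i y * curvUp G j m y + curvUp G j m y * connMatT G i y)
      + (mpd j (curvUp G m i) y + connMat G j y * curvUp G m i y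
        + curvUp G m i y * connMatT G j y)) i m = 0 := by
    simp only [hG.bianchi_curvUp hy, Matrix.zero_apply, Finset.sum_const_zero]
  simp only [Matrix.add_apply, Matrix.mul_apply, Finset.sum_add_distrib] at hsum
  have s1a : ∑ i, ∑ m, mpd m (curvUp G i j) y i m = ∑ m, mpd m (ricUp G) y m j := by
    rw [Finset.sum_comm]
    exact Finset.sum_congr rfl fun m _ => (hG.mpd_ricUp_apply hy m m j).symm
  have s1b : ∑ i, ∑ m, ∑ p, connMat G m y i p * curvUp G i j y p m = 0 :=
    Finset.sum_eq_zero fun i _ => sum_symm_mul_antisymm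
      (fun a b => hG.connMat_symm hy i a b) (fun a b => hanti i j b a)
  have s1c : ∑ i, ∑ m, ∑ p, curvUp G i j y i p * connMatT G m y p m =
      ∑ m, ∑ p, connMat G m y m p * ricUp G y p j := by
    rw [Finset.sum_comm]
    refine Finset.sum_congr rfl fun m _ => ?_
    rw [Finset.sum_comm]
    refine Finset.sum_congr rfl fun p _ => ?_
    rw [hG.ricUp_apply hy, ← Finset.sum_mul, mul_comm]
    rfl
  have s2a : ∑ i, ∑ m, mpd i (curvUp G j m) y i m = ∑ m, mpd m (ricUp G) y m j := by
    refine Finset.sum_congr rfl fun i _ => ?_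
    rw [hG.mpd_ricUp_apply hy]
    refine Finset.sum_congr rfl fun m _ => ?_
    rw [mpd_curvUp_swap i m j, hG.mpd_curvUp_antisymm hy i m j m i, neg_neg]
  have s2b : ∑ i, ∑ m, ∑ p, connMat G i y i p * curvUp G j m y p m =
      ∑ m, ∑ p, connMat G m y m p * ricUp G y p j := by
    refine Finset.sum_congr rfl fun i _ => ?_
    rw [Finset.sum_comm]
    refine Finset.sum_congr rfl fun p _ => ?_
    rw [hG.ricUp_apply hy, ← Finset.mul_sum]
    congr 1
    refine Finset.sum_congr rfl fun m _ => ?_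
    rw [hswap m j, hanti m j m p, neg_neg]
  have s2c : ∑ i, ∑ m, ∑ p, curvUp G j m y i p * connMatT G i y p m = 0 := by
    rw [Finset.sum_comm]
    refine Finset.sum_eq_zero fun m _ => ?_
    rw [Finset.sum_comm, ← sum_symm_mul_antisymm (n := n)
      (fun a b => hG.connMat_symm hy m a b) (fun a b => hanti j m b a)]
    refine Finset.sum_congr rfl fun p _ => Finset.sum_congr rfl fun i _ => ?_
    rw [mul_comm, hG.connMat_symm hy m p i]
    rfl
  have s3a : ∑ i, ∑ m, mpd j (curvUp G m i) y i m = -∑ m, mpd j (ricUp G) y m m := by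
    rw [Finset.sum_comm, ← Finset.sum_neg_distrib]
    refine Finset.sum_congr rfl fun m _ => ?_
    rw [hG.mpd_ricUp_apply hy, ← Finset.sum_neg_distrib]
    exact Finset.sum_congr rfl fun i _ => mpd_curvUp_swap j i m i m
  have s3b : ∑ i, ∑ m, ∑ p, connMat G j y i p * curvUp G m i y p m =
      -∑ i, ∑ p, connMat G j y i p * ricUp G y p i := by
    rw [← Finset.sum_neg_distrib]
    refine Finset.sum_congr rfl fun i _ => ?_
    rw [Finset.sum_comm, ← Finset.sum_neg_distrib]
    refine Finset.sum_congr rfl fun p _ => ?_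
    rw [hG.ricUp_apply hy, ← Finset.mul_sum, ← mul_neg, ← Finset.sum_neg_distrib]
    congr 1
    exact Finset.sum_congr rfl fun m _ => hanti m i m p
  have s3c : ∑ i, ∑ m, ∑ p, curvUp G m i y i p * connMatT G j y p m =
      -∑ i, ∑ p, connMat G j y i p * ricUp G y p i := by
    rw [← Finset.sum_neg_distrib, Finset.sum_comm]
    refine Finset.sum_congr rfl fun m _ => ?_
    rw [Finset.sum_comm, ← Finset.sum_neg_distrib]
    refine Finset.sum_congr rfl fun p _ => ?_
    rw [hG.ricUp_apply hy, ← Finset.sum_mul, ← mul_neg, ← Finset.sum_neg_distrib, mul_comm]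
    congr 1
    exact Finset.sum_congr rfl fun i _ => hswap i m i p
  have hcov : ∑ m, cov G m (ricUp G) y m j = ∑ m, mpd m (ricUp G) y m j
      + ∑ m, ∑ p, connMat G m y m p * ricUp G y p j
      - ∑ i, ∑ p, connMat G j y i p * ricUp G y p i := by
    have : ∑ i, ∑ p, connMat G j y i p * ricUp G y p i =
        ∑ m, ∑ p, ricUp G y m p * connMat G m y p j := by
      rw [Finset.sum_comm]
      refine Finset.sum_congr rfl fun m _ => Finset.sum_congr rfl fun p _ => ?_
      rw [mul_comm, hG.connMat_symm hy p m j]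
    rw [this, ← Finset.sum_add_distrib, ← Finset.sum_sub_distrib]
    rfl
  rw [pd_trace hG.isOpen hG.smooth_ricUp hy, Matrix.trace, hcov]
  simp only [Matrix.diag_apply]
  rw [s1a, s1b, s1c, s2a, s2b, s2c, s3a, s3b, s3c] at hsum
  linarith

theorem cov_congr (hG : IsMetricOn U G) {V W : MatField n} (h : ∀ z ∈ U, V z = W z)
    (hy : y ∈ U) (i : Fin n) : cov G i V y = cov G i W y := by
  simp only [cov, Pi.add_apply, Pi.sub_apply, Pi.mul_apply, mpd_congr hG.isOpen h hy, h y hy]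

theorem cov_add (hG : IsMetricOn U G) {V W : MatField n} (hV : MatSmooth U V)
    (hW : MatSmooth U W) (hy : y ∈ U) (i : Fin n) :
    cov G i (V + W) y = cov G i V y + cov G i W y := by
  simp only [cov, Pi.add_apply, Pi.sub_apply, Pi.mul_apply, mpd_add hG.isOpen hV hW hy]
  noncomm_ring

/-- The commutator with the connection matrix has zero trace. -/
theorem trace_cov (hG : IsMetricOn U G) {V : MatField n} (hV : MatSmooth U V) (hy : y ∈ U)
    (i : Fin n) : (cov G i V y).trace = pd i (fun z => (V z).trace) y := by
  rw [pd_trace hG.isOpen hV hy]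
  simp only [cov, Pi.add_apply, Pi.sub_apply, Pi.mul_apply, Matrix.trace_sub, Matrix.trace_add]
  rw [Matrix.trace_mul_comm (V y)]
  ring

/-- Again `g⁻¹` is parallel: it passes through the derivative, leaving the covariant derivative of
`φ` with both indices down. This connects `cov` with the component definition of the divergence. -/
theorem cov_invMat_mul (hG : IsMetricOn U G) {φ : MatField n} (hφ : MatSmooth U φ) (hy : y ∈ U)
    (i : Fin n) : cov G i (invMat G * φ) y =
      invMat G y * (mpd i φ y - connMatT G i y * φ y - φ y * connMat G i y) := by
  simp only [cov, Pi.add_apply, Pi.sub_apply, Pi.mul_apply,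
    mpd_mul hG.isOpen hG.smooth_invMat hφ hy, hG.mpd_invMat hy]
  noncomm_ring

theorem divergence_eq (hG : IsMetricOn U G) {φ : Fin n → Fin n → Coord n → ℝ}
    (hφ : MatSmooth U (compMat φ)) (hy : y ∈ U) (j : Fin n) :
    divergence G φ j y = -∑ i, cov G i (invMat G * compMat φ) y i j := by
  simp only [divergence]
  congr 1
  refine Finset.sum_congr rfl fun i _ => ?_
  rw [hG.cov_invMat_mul hφ hy, Matrix.mul_apply]
  refine Finset.sum_congr rfl fun k _ => ?_
  congr 1
  simp only [Matrix.sub_apply, Matrix.mul_apply]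
  congr 1
  exact Finset.sum_congr rfl fun l _ => mul_comm _ _

theorem trace_eq (hG : IsMetricOn U G) (φ : Fin n → Fin n → Coord n → ℝ) (hy : y ∈ U) :
    trace G φ y = (invMat G y * compMat φ y).trace := by
  simp only [trace, Matrix.trace, Matrix.diag_apply, Matrix.mul_apply]
  rw [Finset.sum_comm]
  refine Finset.sum_congr rfl fun i _ => Finset.sum_congr rfl fun k _ => ?_
  rw [← congrFun (congrFun (hG.invMat_transpose hy) i) k]
  rfl

end IsMetricOn

end Contraction

/-! ## Lie derivatives of the metric and of the connection -/

section Lie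

open Matrix

variable {n : ℕ} {U : Set (Coord n)} {G : Fin n → Fin n → Coord n → ℝ} {y : Coord n}
  {ξ θ : Fin n → Coord n → ℝ}

/-- The matrix `∂_i ξ^l`. -/
noncomputable def jac (ξ : Fin n → Coord n → ℝ) : MatField n :=
  fun z => Matrix.of fun l i => pd i (ξ l) z

/-- The part `ξ^m Γ^l_{mi}` of `∇_i ξ^l`. -/
noncomputable def connAlong (G : Fin n → Fin n → Coord n → ℝ) (ξ : Fin n → Coord n → ℝ) :
    MatField n :=
  fun z => ∑ m, ξ m z • connMat G m z

/-- The covariant derivative `∇_i ξ^l`. -/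
noncomputable def gradVec (G : Fin n → Fin n → Coord n → ℝ) (ξ : Fin n → Coord n → ℝ) :
    MatField n :=
  jac ξ + connAlong G ξ

/-- The transpose of `∇_i ξ^l`. -/
noncomputable def gradVecT (G : Fin n → Fin n → Coord n → ℝ) (ξ : Fin n → Coord n → ℝ) :
    MatField n :=
  fun z => (gradVec G ξ z)ᵀ

/-- The Lie derivative `(L_ξ Γ)^k_{ij}` of the Levi-Civita connection, as a matrix in `k, j`. -/
noncomputable def lieConn (G : Fin n → Fin n → Coord n → ℝ) (ξ : Fin n → Coord n → ℝ)
    (i : Fin n) (y : Coord n) : Matrix (Fin n) (Fin n) ℝ :=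
  mpd i (jac ξ) y + connMat G i y * jac ξ y - jac ξ y * connMat G i y
    + ∑ m, ξ m y • mpd m (connMat G i) y + ∑ m, pd i (ξ m) y • connMat G m y

namespace IsMetricOn

theorem smooth_jac (hG : IsMetricOn U G) (hξ : ∀ i, ContDiffOn ℝ ∞ (ξ i) U) :
    MatSmooth U (jac ξ) :=
  fun l i => contDiffOn_pd hG.isOpen (hξ l) i

theorem smooth_connAlong (hG : IsMetricOn U G) (hξ : ∀ i, ContDiffOn ℝ ∞ (ξ i) U) :
    MatSmooth U (connAlong G ξ) :=
  MatSmooth.sum Finset.univ (F := fun m z => ξ m z • connMat G m z) fun m _ => (hG.smooth_connMat m).smul (hξ m)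

theorem smooth_gradVec (hG : IsMetricOn U G) (hξ : ∀ i, ContDiffOn ℝ ∞ (ξ i) U) :
    MatSmooth U (gradVec G ξ) :=
  (hG.smooth_jac hξ).add (hG.smooth_connAlong hξ)

theorem smooth_gradVecT (hG : IsMetricOn U G) (hξ : ∀ i, ContDiffOn ℝ ∞ (ξ i) U) :
    MatSmooth U (gradVecT G ξ) :=
  (hG.smooth_gradVec hξ).transpose

/-- Metric compatibility turns `ξ^l ∂_l g` into the connection terms that complete the partial
derivatives of `ξ` to `∇ξ`, so `L_ξ g` is twice the symmetrised lowered `∇ξ`. -/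
theorem lieMetric_eq (hG : IsMetricOn U G) (ξ : Fin n → Coord n → ℝ) (hy : y ∈ U) :
    compMat (lieMetric G ξ) y = (compMat G * gradVec G ξ + gradVecT G ξ * compMat G) y := by
  have h1 : compMat (lieMetric G ξ) y = ∑ l, ξ l y • mpd l (compMat G) y
      + (jac ξ y)ᵀ * compMat G y + compMat G y * jac ξ y := by
    ext i j
    simp only [Matrix.add_apply, Matrix.sum_apply, Matrix.mul_apply]
    rw [← Finset.sum_add_distrib, ← Finset.sum_add_distrib]
    change ∑ l, (ξ l y * pd l (G i j) y + G l j y * pd i (ξ l) y + G i l y * pd j (ξ l) y) = _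
    refine Finset.sum_congr rfl fun l _ => ?_
    change _ = ξ l y * pd l (G i j) y + pd i (ξ l) y * G l j y + G i l y * pd j (ξ l) y
    ring
  rw [h1]
  simp only [hG.mpd_metric hy, gradVec, gradVecT, connAlong, Pi.add_apply, Pi.mul_apply,
    Matrix.transpose_add, Matrix.transpose_sum, Matrix.transpose_smul, mul_add, add_mul,
    Finset.mul_sum, Finset.sum_mul, smul_add, Finset.sum_add_distrib, Matrix.mul_smul,
    Matrix.smul_mul, connMatT]
  abel

theorem smooth_lieMetric (hG : IsMetricOn U G) (hξ : ∀ i, ContDiffOn ℝ ∞ (ξ i) U) :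
    MatSmooth U (compMat (lieMetric G ξ)) :=
  ((hG.smooth_compMat.mul (hG.smooth_gradVec hξ)).add
    ((hG.smooth_gradVecT hξ).mul hG.smooth_compMat)).congr fun _ hz => hG.lieMetric_eq ξ hz

/-- The curvature endomorphism is skew-adjoint for `g`; this is the antisymmetry of `F g⁻¹` with the
index lowered again. -/
theorem curvMat_add_adjoint (hG : IsMetricOn U G) (hy : y ∈ U) (i j : Fin n) :
    curvMat G i j y + invMat G y * (curvMat G i j y)ᵀ * compMat G y = 0 := by
  have h := hG.curvUp_transpose hy i j
  simp only [curvUp, Pi.mul_apply, Matrix.transpose_mul, hG.invMat_transpose hy] at h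
  rw [h, neg_mul, mul_assoc, hG.inv_mul hy, mul_one, add_neg_cancel]

theorem mpd_connAlong (hG : IsMetricOn U G) (hξ : ∀ i, ContDiffOn ℝ ∞ (ξ i) U) (hy : y ∈ U)
    (i : Fin n) : mpd i (connAlong G ξ) y =
      ∑ m, pd i (ξ m) y • connMat G m y + ∑ m, ξ m y • mpd i (connMat G m) y := by
  change mpd i (fun z => ∑ m, ξ m z • connMat G m z) y = _
  rw [mpd_sum _ hG.isOpen (fun m _ => (hG.smooth_connMat m).smul (hξ m)) hy,
    ← Finset.sum_add_distrib]
  exact Finset.sum_congr rfl fun m _ => mpd_smul hG.isOpen (hξ m) (hG.smooth_connMat m) hy i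

/-- `(L_ξ Γ)_i = ∇_i ∇ξ + ξ^m F_{mi}`. -/
theorem lieConn_eq (hG : IsMetricOn U G) (hξ : ∀ i, ContDiffOn ℝ ∞ (ξ i) U) (hy : y ∈ U)
    (i : Fin n) : lieConn G ξ i y = cov G i (gradVec G ξ) y + ∑ m, ξ m y • curvMat G m i y := by
  simp only [cov, Pi.add_apply, Pi.sub_apply, Pi.mul_apply]
  rw [gradVec, mpd_add hG.isOpen (hG.smooth_jac hξ) (hG.smooth_connAlong hξ) hy,
    hG.mpd_connAlong hξ hy]
  simp only [lieConn, curvMat, connAlong, Pi.add_apply, Pi.sub_apply, Pi.mul_apply, mul_add,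
    add_mul, Finset.mul_sum, Finset.sum_mul, Matrix.mul_smul, Matrix.smul_mul, smul_add, smul_sub,
    Finset.sum_add_distrib, Finset.sum_sub_distrib]
  abel

/-- With `B = ∇ξ` and `*` the `g`-adjoint, `g⁻¹ L_ξ g = B + B*`, and `∇_i` commutes with `*`. By
`lieConn_eq`, `(L_ξ Γ)_i` differs from `∇_i B` by the curvature term `ξ^m F_{mi}`, which is
skew-adjoint and so drops out of the sum of an endomorphism with its adjoint. -/
theorem cov_lieMetric (hG : IsMetricOn U G) (hξ : ∀ i, ContDiffOn ℝ ∞ (ξ i) U) (hy : y ∈ U)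
    (i : Fin n) : cov G i (invMat G * compMat (lieMetric G ξ)) y =
      lieConn G ξ i y + invMat G y * (lieConn G ξ i y)ᵀ * compMat G y := by
  have hB := hG.smooth_gradVec hξ
  have hBT := hG.smooth_gradVecT hξ
  have hF : ∑ m, ξ m y • curvMat G m i y
      + invMat G y * (∑ m, ξ m y • curvMat G m i y)ᵀ * compMat G y = 0 := by
    simp only [Matrix.transpose_sum, Finset.mul_sum, Finset.sum_mul, ← Finset.sum_add_distrib]
    refine Finset.sum_eq_zero fun m _ => ?_
    rw [Matrix.transpose_smul, Matrix.mul_smul, Matrix.smul_mul, ← smul_add,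
      hG.curvMat_add_adjoint hy, smul_zero]
  rw [hG.cov_invMat_mul (hG.smooth_lieMetric hξ) hy,
    mpd_congr hG.isOpen (fun z hz => hG.lieMetric_eq ξ hz) hy, hG.lieMetric_eq ξ hy,
    mpd_add hG.isOpen (hG.smooth_compMat.mul hB) (hBT.mul hG.smooth_compMat) hy,
    mpd_mul hG.isOpen hG.smooth_compMat hB hy, mpd_mul hG.isOpen hBT hG.smooth_compMat hy,
    hG.mpd_metric hy, hG.lieConn_eq hξ hy,
    show mpd i (gradVecT G ξ) y = (mpd i (gradVec G ξ) y)ᵀ from rfl]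
  have h1 : ∀ X, invMat G y * (compMat G y * X) = X := fun X => by
    rw [← mul_assoc, hG.inv_mul hy, one_mul]
  have h2 : cov G i (gradVec G ξ) y = mpd i (gradVec G ξ) y + connMat G i y * gradVec G ξ y
    - gradVec G ξ y * connMat G i y := rfl
  have h3 : ∀ X S : Matrix (Fin n) (Fin n) ℝ, S + invMat G y * Sᵀ * compMat G y = 0 →
      X + S + invMat G y * (X + S)ᵀ * compMat G y = X + invMat G y * Xᵀ * compMat G y := by
    intro X S hS
    rw [Matrix.transpose_add, mul_add, add_mul, add_add_add_comm, hS, add_zero]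
  rw [h3 _ _ hF, h2]
  simp only [Pi.add_apply, Pi.mul_apply, Matrix.transpose_add, Matrix.transpose_sub,
    Matrix.transpose_mul, mul_add, mul_sub, add_mul, sub_mul, mul_assoc, h1, gradVecT, connMatT]
  abel

/-- Inherited from the symmetry of `Γ` and of the second derivatives of `ξ`; the two terms with
first derivatives of `ξ` on the lower indices exchange roles. -/
theorem lieConn_symm (hG : IsMetricOn U G) (hξ : ∀ i, ContDiffOn ℝ ∞ (ξ i) U) (hy : y ∈ U)
    (k i j : Fin n) : lieConn G ξ i y k j = lieConn G ξ j y k i := by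
  have h1 : mpd i (jac ξ) y k j = mpd j (jac ξ) y k i := pd_comm hG.isOpen (hξ k) hy i j
  have h2 : ∀ m, mpd m (connMat G i) y k j = mpd m (connMat G j) y k i := fun m =>
    pd_congr hG.isOpen (fun z hz => hG.connMat_symm hz k i j) hy m
  simp only [lieConn, Matrix.add_apply, Matrix.sub_apply, Matrix.mul_apply, Matrix.sum_apply,
    Matrix.smul_apply, smul_eq_mul, h1, h2]
  have h3 : ∀ i j, ∑ p, connMat G i y k p * jac ξ y p j = ∑ p, pd j (ξ p) y * connMat G p y k i :=
    fun i j => Finset.sum_congr rfl fun p _ => by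
      rw [mul_comm, hG.connMat_symm hy k i p]
      rfl
  rw [h3 i j, h3 j i]
  simp only [fun l => hG.connMat_symm hy l j i]
  ring

theorem trace_lieMetric (hG : IsMetricOn U G) (ξ : Fin n → Coord n → ℝ) (hy : y ∈ U) :
    (invMat G y * compMat (lieMetric G ξ) y).trace = 2 * (gradVec G ξ y).trace := by
  rw [hG.lieMetric_eq ξ hy]
  simp only [Pi.add_apply, Pi.mul_apply, mul_add, gradVecT]
  rw [← mul_assoc, hG.inv_mul hy, one_mul, Matrix.trace_add, Matrix.trace_mul_comm (invMat G y),
    mul_assoc, hG.mul_inv hy, mul_one, Matrix.trace_transpose]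
  ring

/-- Differentiating `g^{ij}` in `∂_i(g^{ij} θ_j)` yields two connection terms. One cancels the trace
of `connAlong`; the other is the Christoffel term of `∇_i θ_j` in `δθ`. -/
theorem codiff_eq (hG : IsMetricOn U G) (hθ : ∀ i, ContDiffOn ℝ ∞ (θ i) U) (hy : y ∈ U) :
    codiff G θ y = -(gradVec G (sharp G θ) y).trace := by
  have hJ : ∀ i, pd i (sharp G θ i) y = ∑ j, (mpd i (invMat G) y i j * θ j y
      + ginv G i j y * pd i (θ j) y) := fun i => by
    change pd i (fun z => ∑ j, ginv G i j z * θ j z) y = _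
    rw [pd_sum _ hG.isOpen (fun j _ => (hG.smooth_ginv i j).mul (hθ j)) hy]
    exact Finset.sum_congr rfl fun j _ => pd_mul hG.isOpen (hG.smooth_ginv i j) (hθ j) hy i
  have hI : ∀ i j, mpd i (invMat G) y i j = -(∑ p, christoffel G i i p y * ginv G p j y)
      - ∑ p, ginv G i p y * christoffel G j i p y := fun i j => by
    rw [hG.mpd_invMat hy, neg_add']
    rfl
  have hA : (connAlong G (sharp G θ) y).trace =
      ∑ i, ∑ j, (∑ p, christoffel G i i p y * ginv G p j y) * θ j y := by
    simp only [connAlong, Matrix.trace, Matrix.diag_apply, Matrix.sum_apply, Matrix.smul_apply,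
      smul_eq_mul]
    refine Finset.sum_congr rfl fun i _ => ?_
    simp only [Finset.sum_mul]
    rw [Finset.sum_comm]
    refine Finset.sum_congr rfl fun p _ => ?_
    rw [hG.connMat_symm hy i p i, sharp, Finset.sum_mul]
    refine Finset.sum_congr rfl fun j _ => ?_
    change _ * christoffel G i i p y = _
    ring
  have hC : ∀ i, ∑ j, ginv G i j y * ∑ k, christoffel G k i j y * θ k y =
      ∑ j, (∑ p, ginv G i p y * christoffel G j i p y) * θ j y := fun i => by
    simp only [Finset.mul_sum, Finset.sum_mul]
    rw [Finset.sum_comm]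
    exact Finset.sum_congr rfl fun k _ => Finset.sum_congr rfl fun j _ => by ring
  rw [gradVec, Pi.add_apply, Matrix.trace_add, hA]
  simp only [codiff, mul_sub, Finset.sum_sub_distrib, hC]
  rw [show (jac (sharp G θ) y).trace = ∑ i, pd i (sharp G θ i) y from rfl]
  simp only [hJ, hI, sub_mul, neg_mul, Finset.sum_add_distrib, Finset.sum_sub_distrib,
    Finset.sum_neg_distrib]
  ring

theorem smooth_sharp (hG : IsMetricOn U G) (hθ : ∀ i, ContDiffOn ℝ ∞ (θ i) U) (i : Fin n) :
    ContDiffOn ℝ ∞ (sharp G θ i) U :=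
  ContDiffOn.sum fun j _ => (hG.smooth_ginv i j).mul (hθ j)

theorem cov_smul (hG : IsMetricOn U G) {c : Coord n → ℝ} {V : MatField n}
    (hc : ContDiffOn ℝ ∞ c U) (hV : MatSmooth U V) (hy : y ∈ U) (i : Fin n) :
    cov G i (fun z => c z • V z) y = pd i c y • V y + c y • cov G i V y := by
  simp only [cov, Pi.add_apply, Pi.sub_apply, Pi.mul_apply, mpd_smul hG.isOpen hc hV hy,
    Matrix.mul_smul, Matrix.smul_mul, smul_add, smul_sub]
  abel

theorem smooth_deltaStar (hG : IsMetricOn U G) (hθ : ∀ i, ContDiffOn ℝ ∞ (θ i) U) :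
    MatSmooth U (compMat (deltaStar G θ)) :=
  (hG.smooth_lieMetric (hG.smooth_sharp hθ)).smul (c := fun _ => 1 / 2) contDiffOn_const

theorem trace_deltaStar (hG : IsMetricOn U G) (hθ : ∀ i, ContDiffOn ℝ ∞ (θ i) U) (hy : y ∈ U) :
    (invMat G y * compMat (deltaStar G θ) y).trace = -codiff G θ y := by
  have h : compMat (deltaStar G θ) y = (1 / 2 : ℝ) • compMat (lieMetric G (sharp G θ)) y := rfl
  rw [h, Matrix.mul_smul, Matrix.trace_smul, hG.trace_lieMetric _ hy, hG.codiff_eq hθ hy,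
    smul_eq_mul]
  ring

theorem divergence_deltaStar (hG : IsMetricOn U G) (hθ : ∀ i, ContDiffOn ℝ ∞ (θ i) U)
    (hy : y ∈ U) (j : Fin n) : divergence G (deltaStar G θ) j y =
      -((1 / 2) * ∑ i, cov G i (invMat G * compMat (lieMetric G (sharp G θ))) y i j) := by
  have hL := hG.smooth_lieMetric (hG.smooth_sharp hθ)
  rw [hG.divergence_eq (hG.smooth_deltaStar hθ) hy, Finset.mul_sum]
  congr 1
  refine Finset.sum_congr rfl fun i _ => ?_
  have h : invMat G * compMat (deltaStar G θ) =
      fun z => (1 / 2 : ℝ) • (invMat G * compMat (lieMetric G (sharp G θ))) z := by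
    funext z
    exact Matrix.mul_smul (invMat G z) (1 / 2 : ℝ) (compMat (lieMetric G (sharp G θ)) z)
  rw [h, hG.cov_smul (c := fun _ => 1 / 2) contDiffOn_const (hG.smooth_invMat.mul hL) hy]
  simp

/-- The Sampson Laplacian is minus the metric trace of the Lie derivative of the connection. -/
theorem sampson_eq (hG : IsMetricOn U G) (hθ : ∀ i, ContDiffOn ℝ ∞ (θ i) U) (hy : y ∈ U)
    (j : Fin n) : sampson G θ j y =
      -∑ b, G j b y * ∑ i, ∑ a, ginv G i a y * lieConn G (sharp G θ) i y b a := by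
  have hξ := hG.smooth_sharp hθ
  have hL := hG.smooth_lieMetric hξ
  set ξ := sharp G θ
  -- `δθ` is minus half the trace of `g⁻¹ L_ξ g`, and an endomorphism and its adjoint have equal
  -- traces.
  have htr : pd j (codiff G θ) y = -(lieConn G ξ j y).trace := by
    rw [pd_congr hG.isOpen (f' := fun z => -((1 / 2) *
        ((invMat G * compMat (lieMetric G ξ)) z).trace))
      (fun z hz => by
        rw [hG.codiff_eq hθ hz, Pi.mul_apply, hG.trace_lieMetric ξ hz]; ring) hy, pd_neg,
      pd_mul hG.isOpen contDiffOn_const (hG.smooth_invMat.mul hL).trace hy,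
      ← hG.trace_cov (hG.smooth_invMat.mul hL) hy, hG.cov_lieMetric hξ hy, Matrix.trace_add,
      Matrix.trace_mul_comm (_ * _), ← mul_assoc, hG.mul_inv hy, one_mul, Matrix.trace_transpose,
      pd_const]
    ring
  -- Symmetry of `L_ξ Γ` turns the first half into the full trace, which will cancel `dδθ`; the
  -- adjoint half is the metric trace with its index lowered.
  have hdiv : ∑ i, cov G i (invMat G * compMat (lieMetric G ξ)) y i j =
      (lieConn G ξ j y).trace
        + ∑ b, G j b y * ∑ i, ∑ a, ginv G i a y * lieConn G ξ i y b a := by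
    simp only [hG.cov_lieMetric hξ hy, Matrix.add_apply, Finset.sum_add_distrib]
    congr 1
    · exact Finset.sum_congr rfl fun i _ => hG.lieConn_symm hξ hy i i j
    · simp only [Matrix.mul_apply, Finset.mul_sum, Finset.sum_mul]
      rw [Finset.sum_comm]
      refine Finset.sum_congr rfl fun b _ => Finset.sum_congr rfl fun i _ =>
        Finset.sum_congr rfl fun a _ => ?_
      change ginv G i a y * lieConn G ξ i y b a * G b j y = _
      rw [hG.symm y hy b j]
      ring
  rw [sampson, hG.divergence_deltaStar hθ hy, hdiv, htr]
  ring

/-- The coordinate form of the formula `Δ_S θ = -(n - 2) d lam`. -/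
theorem sampson_of_york (hG : IsMetricOn U G) (hθ : ∀ i, ContDiffOn ℝ ∞ (θ i) U)
    {lam : Coord n → ℝ} (hlam : ContDiffOn ℝ ∞ lam U) {φ : Fin n → Fin n → Coord n → ℝ}
    (hφ : MatSmooth U (compMat φ)) (hdiv : ∀ z ∈ U, ∀ j, divergence G φ j z = 0)
    (htr : ∀ z ∈ U, trace G φ z = 0)
    (hRic : ∀ z ∈ U, ∀ i j, ricci G i j z =
      (deltaStar G θ i j z + lam z * G i j z) + φ i j z) (hy : y ∈ U) (j : Fin n) :
    sampson G θ j y = -((n : ℝ) - 2) * pd j lam y := by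
  have hD := hG.smooth_deltaStar hθ
  have h1 : MatSmooth U (fun _ => (1 : Matrix (Fin n) (Fin n) ℝ)) := fun a b => contDiffOn_const
  have hup : ∀ z ∈ U, ricUp G z = ((invMat G * compMat (deltaStar G θ))
      + (fun z => lam z • (1 : Matrix (Fin n) (Fin n) ℝ)) + (invMat G * compMat φ)) z := by
    intro z hz
    have : compMat (ricci G) z =
        compMat (deltaStar G θ) z + lam z • compMat G z + compMat φ z := by
      ext a b
      exact hRic z hz a b
    simp only [ricUp, Pi.add_apply, Pi.mul_apply, this, mul_add, Matrix.mul_smul, hG.inv_mul hz]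
  have hs1 := hG.smooth_invMat.mul hD
  have hs2 : MatSmooth U (fun z => lam z • (1 : Matrix (Fin n) (Fin n) ℝ)) := h1.smul hlam
  have hs3 := hG.smooth_invMat.mul hφ
  have hb := hG.contracted_bianchi hy j
  have hcodiff : ContDiffOn ℝ ∞ (codiff G θ) U :=
    (hG.smooth_gradVec (hG.smooth_sharp hθ)).trace.neg.congr fun z hz => hG.codiff_eq hθ hz
  -- The scalar curvature `s = nλ - δθ`.
  have htrace : ∀ z ∈ U, (ricUp G z).trace = n * lam z - codiff G θ z := by
    intro z hz
    rw [hup z hz]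
    simp only [Pi.add_apply, Pi.mul_apply, Matrix.trace_add]
    rw [hG.trace_deltaStar hθ hz, ← hG.trace_eq φ hz, htr z hz, Matrix.trace_smul,
      Matrix.trace_one, Fintype.card_fin, smul_eq_mul]
    ring
  -- This is `-δRic`: the identity endomorphism is parallel, so `λg` contributes only `dλ`.
  have hcov : ∑ m, cov G m (ricUp G) y m j =
      -divergence G (deltaStar G θ) j y + pd j lam y := by
    have h0 := hdiv y hy j
    rw [hG.divergence_eq hφ hy] at h0
    rw [hG.divergence_eq hD hy, neg_neg]
    simp only [fun m => hG.cov_congr hup hy m, hG.cov_add (hs1.add hs2) hs3 hy,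
      hG.cov_add hs1 hs2 hy, hG.cov_smul hlam h1 hy, Matrix.add_apply, Finset.sum_add_distrib]
    rw [neg_eq_zero.mp h0]
    have hone : ∀ m, cov G m (fun _ => (1 : Matrix (Fin n) (Fin n) ℝ)) y = 0 := fun m => by
      have : mpd m (fun _ => (1 : Matrix (Fin n) (Fin n) ℝ)) y = 0 := by
        ext a b
        simp [mpd_apply]
      simp [cov, this]
    simp [hone, Matrix.one_apply]
  rw [hcov, pd_congr hG.isOpen htrace hy,
    pd_sub hG.isOpen (contDiffOn_const.mul hlam) hcodiff hy,
    pd_mul hG.isOpen contDiffOn_const hlam hy, pd_const] at hb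
  rw [sampson]
  linarith

end IsMetricOn

end Lie

/-! ## The first variation of the tension field -/

section Variation

variable {n : ℕ}

/-! ### Interchange of time and space derivatives -/

section Slices

variable {F : ℝ × Coord n → ℝ} {y z : Coord n} {t : ℝ}

theorem pd_slice (hF : DifferentiableAt ℝ F (t, z)) (i : Fin n) :
    pd i (fun w => F (t, w)) z = fderiv ℝ F (t, z) (0, EuclideanSpace.single i 1) := by
  have h : HasFDerivAt (fun w => F (t, w)) _ z :=
    hF.hasFDerivAt.comp z (hasFDerivAt_prodMk_right t z)
  simp [pd, h.fderiv]

theorem hasDerivAt_slice (hF : DifferentiableAt ℝ F (t, z)) :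
    HasDerivAt (fun s => F (s, z)) (fderiv ℝ F (t, z) (1, 0)) t := by
  have h : HasFDerivAt (fun s => F (s, z)) _ t :=
    hF.hasFDerivAt.comp t (hasFDerivAt_prodMk_left t z)
  simpa using h.hasDerivAt

theorem eventually_differentiableAt {p : ℝ × Coord n} (hF : ContDiffAt ℝ 2 F p) :
    ∀ᶠ q in 𝓝 p, DifferentiableAt ℝ F q := by
  filter_upwards [hF.eventually (by simp)] with q hq using hq.differentiableAt (by simp)

theorem differentiableAt_fderiv_apply {p : ℝ × Coord n} (hF : ContDiffAt ℝ 2 F p)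
    (v : ℝ × Coord n) : DifferentiableAt ℝ (fun q => fderiv ℝ F q v) p :=
  ((hF.fderiv_right (m := 1) (by norm_num)).differentiableAt (by simp)).clm_apply
    (differentiableAt_const v)

theorem fderiv_fderiv_comm {p : ℝ × Coord n} (hF : ContDiffAt ℝ 2 F p) (v w : ℝ × Coord n) :
    fderiv ℝ (fun q => fderiv ℝ F q v) p w = fderiv ℝ (fun q => fderiv ℝ F q w) p v := by
  have hd : DifferentiableAt ℝ (fderiv ℝ F) p :=
    (hF.fderiv_right (m := 1) (by norm_num)).differentiableAt (by simp)
  have hs : IsSymmSndFDerivAt ℝ F p := hF.isSymmSndFDerivAt (by simp)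
  rw [fderiv_clm_apply hd (differentiableAt_const _), fderiv_clm_apply hd (differentiableAt_const _)]
  simpa using hs.eq w v

/-- Time and space derivatives of a `C²` function commute. -/
theorem hasDerivAt_pd_slice {η : Coord n → ℝ} (hF : ContDiffAt ℝ 2 F (0, y))
    (hη : ∀ᶠ z in 𝓝 y, HasDerivAt (fun t => F (t, z)) (η z) 0) (i : Fin n) :
    HasDerivAt (fun t => pd i (fun z => F (t, z)) y) (pd i η y) 0 := by
  have hd := eventually_differentiableAt hF
  have h1 := hasDerivAt_slice (differentiableAt_fderiv_apply hF (0, EuclideanSpace.single i 1))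
  have ht : ∀ᶠ t : ℝ in 𝓝 0, DifferentiableAt ℝ F (t, y) :=
    (Continuous.prodMk_left y).continuousAt.eventually hd
  have hz : ∀ᶠ z in 𝓝 y, DifferentiableAt ℝ F ((0 : ℝ), z) :=
    (Continuous.prodMk_right (0 : ℝ)).continuousAt.eventually hd
  have hval : pd i η y =
      fderiv ℝ (fun q => fderiv ℝ F q (0, EuclideanSpace.single i 1)) (0, y) (1, 0) := by
    have hη' : η =ᶠ[𝓝 y] fun z => fderiv ℝ F ((0 : ℝ), z) (1, 0) := by
      filter_upwards [hη, hz] with z h h' using h.unique (hasDerivAt_slice h')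
    rw [fderiv_fderiv_comm hF, ← pd_slice (differentiableAt_fderiv_apply hF _)]
    simp only [pd, hη'.fderiv_eq]
  rw [hval]
  refine h1.congr_of_eventuallyEq ?_
  filter_upwards [ht] with t h using pd_slice h i

theorem hasDerivAt_pd_pd_slice {η : Coord n → ℝ} (hF : ContDiffAt ℝ ∞ F (0, y))
    (hη : ∀ᶠ z in 𝓝 y, HasDerivAt (fun t => F (t, z)) (η z) 0) (i j : Fin n) :
    HasDerivAt (fun t => pd i (pd j fun z => F (t, z)) y) (pd i (pd j η) y) 0 := by
  have h2 : (2 : WithTop ℕ∞) ≤ ∞ := WithTop.coe_le_coe.2 (le_top : (2 : ℕ∞) ≤ ⊤)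
  have hF2 := hF.of_le h2
  have hD : ContDiffAt ℝ ∞ (fun q => fderiv ℝ F q (0, EuclideanSpace.single j 1)) (0, y) :=
    (hF.fderiv_right (m := ∞) (by simp)).clm_apply contDiffAt_const
  have hd := eventually_differentiableAt hF2
  have hz : ∀ᶠ z in 𝓝 y, ContDiffAt ℝ 2 F ((0 : ℝ), z) :=
    (Continuous.prodMk_right (0 : ℝ)).continuousAt.eventually (hF2.eventually (by simp))
  have hη' : ∀ᶠ z in 𝓝 y, HasDerivAt
      (fun t => fderiv ℝ F (t, z) (0, EuclideanSpace.single j 1)) (pd j η z) 0 := by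
    filter_upwards [hz, hη.eventually_nhds] with z h h'
    refine (hasDerivAt_pd_slice h h' j).congr_of_eventuallyEq ?_
    have ht : ∀ᶠ t : ℝ in 𝓝 0, DifferentiableAt ℝ F (t, z) :=
      (Continuous.prodMk_left z).continuousAt.eventually (eventually_differentiableAt h)
    filter_upwards [ht] with t h'' using (pd_slice h'' j).symm
  refine (hasDerivAt_pd_slice (hD.of_le h2) hη' i).congr_of_eventuallyEq ?_
  -- The outer derivative in space needs the inner one on a whole neighbourhood of `y` for each
  -- small `t`.
  have hc : ∀ᶠ t : ℝ in 𝓝 0, ∀ᶠ z in 𝓝 y, DifferentiableAt ℝ F (t, z) := hd.curry_nhds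
  filter_upwards [hc] with t ht
  have : (pd j fun z => F (t, z)) =ᶠ[𝓝 y]
      fun z => fderiv ℝ F (t, z) (0, EuclideanSpace.single j 1) := by
    filter_upwards [ht] with z h using pd_slice h j
  simp only [pd] at this ⊢
  rw [this.fderiv_eq]

end Slices

theorem fderiv_eq_sum_pd (f : Coord n → ℝ) (y v : Coord n) :
    fderiv ℝ f y v = ∑ m, v m * pd m f y := by
  have hv : v = ∑ m, v m • EuclideanSpace.single m (1 : ℝ) := by
    ext k
    simp [Pi.single_apply]
  conv_lhs => rw [hv]
  simp [pd]

theorem pd_coord (i a : Fin n) (y : Coord n) :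
    pd i (fun z : Coord n => z a) y = if a = i then 1 else 0 := by
  have h : HasFDerivAt (fun z : Coord n => z a) (EuclideanSpace.proj (𝕜 := ℝ) a) y :=
    (EuclideanSpace.proj (𝕜 := ℝ) a : Coord n →L[ℝ] ℝ).hasFDerivAt
  simp [pd, h.fderiv]

/-! ### Families of local transformations and their tension fields -/

variable {U : Set (Coord n)} {G : Fin n → Fin n → Coord n → ℝ} {y : Coord n}
  {ξ : Fin n → Coord n → ℝ} {Φ : ℝ → Coord n → Coord n}

theorem IsLocalFamily.contDiffAt_apply (h : IsLocalFamily ξ Φ y) (k : Fin n) :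
    ContDiffAt ℝ ∞ (fun p : ℝ × Coord n => Φ p.1 p.2 k) (0, y) :=
  (EuclideanSpace.proj (𝕜 := ℝ) k : Coord n →L[ℝ] ℝ).contDiff.contDiffAt.comp _ h.1

theorem IsLocalFamily.hasDerivAt_apply (h : IsLocalFamily ξ Φ y) (k : Fin n) :
    ∀ᶠ z in 𝓝 y, HasDerivAt (fun t => Φ t z k) (ξ k z) 0 := by
  filter_upwards [h.2] with z hz using hz.2 k

theorem IsLocalFamily.zero_apply (h : IsLocalFamily ξ Φ y) : Φ 0 y = y :=
  h.2.self_of_nhds.1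

theorem IsLocalFamily.pd_zero (h : IsLocalFamily ξ Φ y) (i a : Fin n) :
    pd i (fun z => Φ 0 z a) y = if a = i then 1 else 0 := by
  have : (fun z => Φ 0 z a) =ᶠ[𝓝 y] fun z => z a := by
    filter_upwards [h.2] with z hz
    rw [hz.1]
  rw [← pd_coord i a y]
  simp only [pd, this.fderiv_eq]

theorem IsLocalFamily.hasDerivAt_comp (h : IsLocalFamily ξ Φ y) {f : Coord n → ℝ}
    (hf : DifferentiableAt ℝ f y) :
    HasDerivAt (fun t => f (Φ t y)) (∑ m, ξ m y * pd m f y) 0 := by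
  have hΦ : DifferentiableAt ℝ (fun t => Φ t y) 0 := by
    have h1 := h.1.differentiableAt (by simp)
    exact DifferentiableAt.comp (g := fun p : ℝ × Coord n => Φ p.1 p.2) (f := fun t => (t, y))
      (0 : ℝ) h1 (hasFDerivAt_prodMk_left (0 : ℝ) y).differentiableAt
  -- Joint smoothness supplies the velocity vector; its components are then identified by uniqueness
  -- of derivatives.
  set v := deriv (fun t => Φ t y) 0
  have hv : HasDerivAt (fun t => Φ t y) v 0 := hΦ.hasDerivAt
  have hvm : ∀ m, v m = ξ m y := fun m =>
    ((EuclideanSpace.proj (𝕜 := ℝ) m : Coord n →L[ℝ] ℝ).hasFDerivAt.comp_hasDerivAt 0 hv).unique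
      (h.hasDerivAt_apply m).self_of_nhds
  have hf' : HasFDerivAt f (fderiv ℝ f y) (Φ 0 y) := by
    rw [h.zero_apply]
    exact hf.hasFDerivAt
  have := hf'.comp_hasDerivAt 0 hv
  rw [fderiv_eq_sum_pd] at this
  simp only [hvm] at this
  exact this

/-- The first variation of the tension field at the identity is the metric trace of the Lie
derivative of the connection. -/
theorem IsMetricOn.hasDerivAt_tension (hG : IsMetricOn U G) (hy : y ∈ U)
    (h : IsLocalFamily ξ Φ y) (k : Fin n) :
    HasDerivAt (fun t => tension G (Φ t) k y)
      (∑ i, ∑ j, ginv G i j y * lieConn G ξ i y k j) 0 := by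
  have h2 : (2 : WithTop ℕ∞) ≤ ∞ := WithTop.coe_le_coe.2 (le_top : (2 : ℕ∞) ≤ ⊤)
  have hpd : ∀ i a, HasDerivAt (fun t => pd i (fun z => Φ t z a) y) (pd i (ξ a) y) 0 :=
    fun i a => hasDerivAt_pd_slice (F := fun p => Φ p.1 p.2 a) ((h.contDiffAt_apply a).of_le h2)
      (h.hasDerivAt_apply a) i
  have hpd2 : ∀ i j, HasDerivAt (fun t => pd i (pd j fun z => Φ t z k) y)
      (pd i (pd j (ξ k)) y) 0 :=
    fun i j => hasDerivAt_pd_pd_slice (F := fun p => Φ p.1 p.2 k) (h.contDiffAt_apply k)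
      (h.hasDerivAt_apply k) i j
  have hΓ : ∀ a b, HasDerivAt (fun t => christoffel G k a b (Φ t y))
      (∑ m, ξ m y * pd m (christoffel G k a b) y) 0 := fun a b =>
    h.hasDerivAt_comp (differentiableAt_of_smooth hG.isOpen (hG.smooth_christoffel k a b) hy)
  refine HasDerivAt.fun_sum fun i _ => HasDerivAt.fun_sum fun j _ => ?_
  -- The right side is what the product rule produces at `t = 0`. There the Jacobian of `Φ_0` is the
  -- identity, and the Kronecker deltas collapse it to `L_ξ Γ`.
  have hlie : lieConn G ξ i y k j = pd i (pd j (ξ k)) y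
      - ∑ l, christoffel G l i j y * pd l (ξ k) y
      + ∑ a, ∑ b, (((∑ m, ξ m y * pd m (christoffel G k a b) y) * pd i (fun z => Φ 0 z a) y
          + christoffel G k a b (Φ 0 y) * pd i (ξ a) y) * pd j (fun z => Φ 0 z b) y
        + christoffel G k a b (Φ 0 y) * pd i (fun z => Φ 0 z a) y * pd j (ξ b) y) := by
    simp only [h.pd_zero, h.zero_apply, mul_ite, mul_one, mul_zero, ite_mul, zero_mul,
      Finset.sum_add_distrib, Finset.sum_ite_eq', Finset.mem_univ, if_true,
      Finset.sum_ite_irrel, Finset.sum_const_zero]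
    have e1 : ∑ l, christoffel G l i j y * pd l (ξ k) y = (jac ξ y * connMat G i y) k j := by
      rw [Matrix.mul_apply]
      exact Finset.sum_congr rfl fun l _ => mul_comm _ _
    have e2 : ∑ a, christoffel G k a j y * pd i (ξ a) y =
        (∑ m, pd i (ξ m) y • connMat G m y) k j := by
      rw [Matrix.sum_apply]
      exact Finset.sum_congr rfl fun l _ => mul_comm _ _
    have e3 : ∑ m, ξ m y * pd m (christoffel G k i j) y =
        (∑ m, ξ m y • mpd m (connMat G i) y) k j := by
      rw [Matrix.sum_apply]
      rfl
    have e4 : ∑ b, christoffel G k i b y * pd j (ξ b) y = (connMat G i y * jac ξ y) k j := by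
      rw [Matrix.mul_apply]
      rfl
    have e5 : pd i (pd j (ξ k)) y = mpd i (jac ξ) y k j := rfl
    rw [e1, e2, e3, e4, e5]
    simp only [lieConn, Matrix.add_apply, Matrix.sub_apply]
    ring
  rw [hlie]
  refine HasDerivAt.const_mul _ ((HasDerivAt.fun_sub (hpd2 i j) ?_).fun_add ?_)
  · exact HasDerivAt.fun_sum fun l _ => (hpd l k).const_mul _
  · exact HasDerivAt.fun_sum fun a _ => HasDerivAt.fun_sum fun b _ =>
      ((hΓ a b).fun_mul (hpd i a)).fun_mul (hpd j b)

/-- Existence of a local family with a given smooth velocity. -/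
theorem isLocalFamily_add_smul (hU : IsOpen U) (hξ : ∀ i, ContDiffOn ℝ ∞ (ξ i) U) (hy : y ∈ U) :
    IsLocalFamily ξ (fun t z => z + t • WithLp.toLp 2 fun k => ξ k z) y := by
  constructor
  · refine contDiffAt_snd.add (contDiffAt_fst.smul ?_)
    refine (contDiffAt_euclidean.2 fun k => ?_)
    exact ((hξ k).contDiffAt (hU.mem_nhds hy)).comp ((0 : ℝ), y) contDiffAt_snd
  · refine Eventually.of_forall fun z => ⟨by simp, fun k => ?_⟩
    have := ((hasDerivAt_id (0 : ℝ)).mul_const (ξ k z)).const_add (z k)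
    simpa using this

end Variation

/-! ## Components of smooth tensor fields in a smooth chart -/

section Components

variable {n : ℕ} {M : Type*} [TopologicalSpace M] [ChartedSpace (Coord n) M]

theorem sum_smul_frame (e : OpenPartialHomeomorph M (Coord n)) (y : Coord n) (c : Fin n → ℝ) :
    ∑ i, c i • frame e i y = mfderiv (𝓡 n) (𝓡 n) e.symm y (WithLp.toLp 2 c : Coord n) := by
  have hc : (WithLp.toLp 2 c : Coord n) = ∑ m, c m • EuclideanSpace.single m (1 : ℝ) := by
    ext k
    simp [Pi.single_apply]
  have hL : ∀ L : Coord n →L[ℝ] TangentSpace (𝓡 n) (e.symm y),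
      L (∑ m, c m • EuclideanSpace.single m (1 : ℝ)) =
        ∑ m, c m • L (EuclideanSpace.single m (1 : ℝ)) := fun L => by
    simp only [map_sum, map_smul]
  rw [hc]
  exact (hL _).symm

variable [IsManifold (𝓡 n) ∞ M] {e : OpenPartialHomeomorph M (Coord n)} {y : Coord n}

theorem mdifferentiable_chart (he : e ∈ charts n M) : e.MDifferentiable (𝓡 n) (𝓡 n) :=
  ⟨(contMDiffOn_of_mem_maximalAtlas he).mdifferentiableOn (by simp),
    (contMDiffOn_symm_of_mem_maximalAtlas he).mdifferentiableOn (by simp)⟩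

/-- The frame is the tangent map of the inverse chart applied to a constant section. -/
theorem contMDiffOn_frame (he : e ∈ charts n M) (i : Fin n) :
    ContMDiffOn (𝓡 n) ((𝓡 n).prod 𝓘(ℝ, Coord n)) ∞
      (fun z => TotalSpace.mk' (Coord n) (E := fun x : M => TangentSpace (𝓡 n) x)
        (e.symm z) (frame e i z)) e.target := by
  have hu : UniqueMDiffOn (𝓡 n) e.target := e.open_target.uniqueMDiffOn
  have h1 := (contMDiffOn_symm_of_mem_maximalAtlas he).contMDiffOn_tangentMapWithin
    (m := ∞) (by simp) hu
  have h2 : ContMDiff (𝓡 n) (𝓡 n).tangent ∞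
      (fun z : Coord n => (⟨z, (EuclideanSpace.single i (1 : ℝ) : Coord n)⟩ :
        TangentBundle (𝓡 n) (Coord n))) := by
    intro z
    exact contMDiffAt_vectorSpace_iff_contDiffAt.2 contDiffAt_const
  refine (h1.comp h2.contMDiffOn (s := e.target) fun z hz => hz).congr fun z hz => ?_
  simp only [Function.comp, tangentMapWithin, mfderivWithin_of_isOpen e.open_target hz]
  rfl

theorem contDiffOn_formComp (he : e ∈ charts n M) (θ : OneForm n M) (i : Fin n) :
    ContDiffOn ℝ ∞ (formComp e θ i) e.target := by
  rw [← contMDiffOn_iff_contDiffOn]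
  intro z hz
  have h1 := (θ.contMDiff.contMDiffAt (x := e.symm z)).comp_contMDiffWithinAt z
    (contMDiffOn_symm_of_mem_maximalAtlas he z hz)
  have h2 := ContMDiffWithinAt.clm_bundle_apply (F₁ := Coord n) (F₂ := ℝ)
    (E₂ := Bundle.Trivial M ℝ) (b := e.symm) h1 (contMDiffOn_frame he i z hz)
  rw [contMDiffWithinAt_totalSpace] at h2
  exact h2.2

theorem contDiffOn_tensorComp (he : e ∈ charts n M)
    {φ : Π x : M, TangentSpace (𝓡 n) x →L[ℝ] TangentSpace (𝓡 n) x →L[ℝ] ℝ}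
    (hφ : ContMDiff (𝓡 n) ((𝓡 n).prod 𝓘(ℝ, Coord n →L[ℝ] Coord n →L[ℝ] ℝ)) ∞
      fun x => TotalSpace.mk' (Coord n →L[ℝ] Coord n →L[ℝ] ℝ)
        (E := fun x : M => TangentSpace (𝓡 n) x →L[ℝ] TangentSpace (𝓡 n) x →L[ℝ] ℝ) x (φ x))
    (i j : Fin n) : ContDiffOn ℝ ∞ (tensorComp e φ i j) e.target := by
  rw [← contMDiffOn_iff_contDiffOn]
  intro z hz
  have h1 := (hφ.contMDiffAt (x := e.symm z)).comp_contMDiffWithinAt z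
    (contMDiffOn_symm_of_mem_maximalAtlas he z hz)
  have h2 := ContMDiffWithinAt.clm_bundle_apply₂ (F₁ := Coord n) (F₂ := Coord n) (F₃ := ℝ)
    (E₃ := Bundle.Trivial M ℝ) (b := e.symm) h1 (contMDiffOn_frame he i z hz)
    (contMDiffOn_frame he j z hz)
  rw [contMDiffWithinAt_totalSpace] at h2
  exact h2.2

theorem contDiffOn_funComp (he : e ∈ charts n M) (lam : C^∞⟮𝓡 n, M; ℝ⟯) :
    ContDiffOn ℝ ∞ (fun z => lam (e.symm z)) e.target := by
  rw [← contMDiffOn_iff_contDiffOn]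
  exact lam.contMDiff.comp_contMDiffOn (contMDiffOn_symm_of_mem_maximalAtlas he)

theorem vec_eq_sum_frame (he : e ∈ charts n M) (ξ : Π x : M, TangentSpace (𝓡 n) x)
    (hy : y ∈ e.target) : ξ (e.symm y) = ∑ i, vecComp e ξ i y • frame e i y := by
  rw [sum_smul_frame]
  have h := (mdifferentiable_chart he).symm_comp_deriv (e.map_target hy)
  rw [e.right_inv hy] at h
  exact (congrArg (fun L : TangentSpace (𝓡 n) (e.symm y) →L[ℝ] TangentSpace (𝓡 n) (e.symm y) =>
    L (ξ (e.symm y))) h).symm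

/-- The coordinate fields are independent because the differential of the inverse chart has a left
inverse. -/
theorem eq_zero_of_sum_smul_frame (he : e ∈ charts n M) (hy : y ∈ e.target) {c : Fin n → ℝ}
    (h : ∑ i, c i • frame e i y = 0) : c = 0 := by
  rw [sum_smul_frame] at h
  have h1 := (mdifferentiable_chart he).comp_symm_deriv hy
  have h2 := congrArg (fun L : Coord n →L[ℝ] Coord n => L (WithLp.toLp 2 c : Coord n)) h1
  have h3 : (WithLp.toLp 2 c : Coord n) = 0 := by
    refine h2.symm.trans ?_
    change mfderiv (𝓡 n) (𝓡 n) e (e.symm y) (mfderiv (𝓡 n) (𝓡 n) e.symm y _) = _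
    rw [h]
    exact map_zero _
  exact congrArg WithLp.ofLp h3

theorem isMetricOn_tensorComp (he : e ∈ charts n M) (g : Metric n M) :
    IsMetricOn e.target (tensorComp e g.inner) where
  isOpen := e.open_target
  smooth := contDiffOn_tensorComp he g.contMDiff
  symm z _ i j := g.symm _ _ _
  det_ne_zero z hz := by
    intro h0
    -- A kernel vector of the Gram matrix gives a tangent vector orthogonal to every frame vector,
    -- hence to itself, contradicting positivity.
    obtain ⟨c, hc, h⟩ := Matrix.exists_vecMul_eq_zero_iff.2 h0
    refine hc (eq_zero_of_sum_smul_frame he hz ?_)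
    by_contra hne
    have hpos := g.pos (e.symm z) _ hne
    refine hpos.ne' ?_
    have hj : ∀ j, g.inner (e.symm z) (∑ i, c i • frame e i z) (frame e j z) = 0 := fun j => by
      have := congrFun h j
      simp only [Matrix.vecMul, dotProduct, Matrix.of_apply, Pi.zero_apply] at this
      rw [map_sum, sum_apply, ← this]
      refine Finset.sum_congr rfl fun i _ => ?_
      rw [map_smul]
      rfl
    rw [map_sum (g.inner (e.symm z) _)]
    refine Finset.sum_eq_zero fun j _ => ?_
    rw [map_smul, hj, smul_zero]

/-- The components of `ξ = θ^♯`. -/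
theorem vecComp_eq_sharp (he : e ∈ charts n M) (g : Metric n M) (ξ : VectorField n M)
    (θ : OneForm n M) (hθ : ∀ (x : M) (v : TangentSpace (𝓡 n) x), θ x v = g.inner x (ξ x) v)
    (hy : y ∈ e.target) (i : Fin n) :
    vecComp e ξ i y = sharp (tensorComp e g.inner) (formComp e θ) i y := by
  have hG := isMetricOn_tensorComp he g
  have h1 : ∀ j, formComp e θ j y = ∑ k, tensorComp e g.inner j k y * vecComp e ξ k y := by
    intro j
    rw [formComp, hθ]
    conv_lhs => rw [vec_eq_sum_frame he ξ hy]
    rw [map_sum, sum_apply]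
    refine Finset.sum_congr rfl fun k _ => ?_
    rw [map_smul, hG.symm y hy j k, mul_comm]
    rfl
  have h2 : (fun j => formComp e θ j y) =
      Matrix.mulVec (compMat (tensorComp e g.inner) y) fun k => vecComp e ξ k y := funext h1
  have h3 : Matrix.mulVec (invMat (tensorComp e g.inner) y) (fun j => formComp e θ j y) =
      fun k => vecComp e ξ k y := by
    rw [h2, Matrix.mulVec_mulVec, hG.inv_mul hy, Matrix.one_mulVec]
  exact (congrFun h3 i).symm

/-- A function with zero differential is constant on a coordinate ball, hence locally constant,
hence constant by connectedness. -/
theorem exists_eq_const_of_pd_eq_zero [PreconnectedSpace M] (lam : C^∞⟮𝓡 n, M; ℝ⟯)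
    (h : ∀ e ∈ charts n M, ∀ y ∈ e.target, ∀ i, pd i (fun z => lam (e.symm z)) y = 0) :
    ∃ c : ℝ, ∀ x, lam x = c := by
  have hloc : IsLocallyConstant (lam : M → ℝ) := by
    rw [IsLocallyConstant.iff_eventually_eq]
    intro x
    set e := chartAt (Coord n) x
    have he : e ∈ charts n M := IsManifold.chart_mem_maximalAtlas x
    have hx : x ∈ e.source := mem_chart_source _ x
    obtain ⟨r, hr, hball⟩ := Metric.isOpen_iff.1 e.open_target (e x) (e.map_source hx)
    have hdiff := contDiffOn_funComp he lam
    have hconst : ∀ z ∈ Metric.ball (e x) r, lam (e.symm z) = lam (e.symm (e x)) := by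
      intro z hz
      refine (convex_ball (e x) r).is_const_of_fderivWithin_eq_zero (𝕜 := ℝ)
        (f := fun z => lam (e.symm z))
        ((hdiff.mono hball).differentiableOn (by simp)) (fun w hw => ?_) hz
        (Metric.mem_ball_self hr)
      rw [fderivWithin_of_isOpen Metric.isOpen_ball hw]
      ext v
      rw [fderiv_eq_sum_pd]
      exact Finset.sum_eq_zero fun i _ => by rw [h e he w (hball hw) i, mul_zero]
    have hnhds : e.source ∩ e ⁻¹' Metric.ball (e x) r ∈ 𝓝 x :=
      (e.isOpen_inter_preimage Metric.isOpen_ball).mem_nhds ⟨hx, Metric.mem_ball_self hr⟩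
    filter_upwards [hnhds] with w hw
    have := hconst (e w) hw.2
    rwa [e.left_inv hw.1, e.left_inv hx] at this
  -- `PreconnectedSpace` admits the empty space, which offers no value to take as the constant.
  rcases isEmpty_or_nonempty M with hM | hM
  · exact ⟨0, fun x => (hM.false x).elim⟩
  · obtain ⟨x₀⟩ := hM
    exact ⟨lam x₀, fun x => hloc.apply_eq_of_preconnectedSpace x x₀⟩

/-- `ξ = θ^♯` is an infinitesimal harmonic transformation if and only if `Δ_S θ = 0`. -/
theorem isInfinitesimalHarmonic_iff (g : Metric n M) (ξ : VectorField n M) (θ : OneForm n M)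
    (hθ : ∀ (x : M) (v : TangentSpace (𝓡 n) x), θ x v = g.inner x (ξ x) v) :
    IsInfinitesimalHarmonic g ξ ↔ ∀ e ∈ charts n M, ∀ y ∈ e.target, ∀ i,
      sampson (tensorComp e g.inner) (formComp e θ) i y = 0 := by
  refine forall₄_congr fun e he y hy => ?_
  have hG := isMetricOn_tensorComp he g
  have hform := contDiffOn_formComp he θ
  have hsharp := fun i => hG.smooth_sharp hform i
  have heq : ∀ z ∈ e.target, ∀ i, vecComp e ξ i z =
      sharp (tensorComp e g.inner) (formComp e θ) i z :=
    fun z hz => vecComp_eq_sharp he g ξ θ hθ hz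
  have hvec : ∀ i, ContDiffOn ℝ ∞ (vecComp e ξ i) e.target :=
    fun i => (hsharp i).congr fun z hz => heq z hz i
  -- The two component functions agree only on the chart's target; its openness carries the
  -- agreement over to derivatives.
  have hlie : ∀ i k j, lieConn (tensorComp e g.inner) (vecComp e ξ) i y k j =
      lieConn (tensorComp e g.inner) (sharp (tensorComp e g.inner) (formComp e θ)) i y k j := by
    intro i k j
    have hpd : ∀ z ∈ e.target, ∀ i l, pd i (vecComp e ξ l) z =
        pd i (sharp (tensorComp e g.inner) (formComp e θ) l) z :=
      fun z hz i l => pd_congr hG.isOpen (fun w hw => heq w hw l) hz i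
    have hjac : ∀ z ∈ e.target, jac (vecComp e ξ) z =
        jac (sharp (tensorComp e g.inner) (formComp e θ)) z := fun z hz => by
      ext l i
      exact hpd z hz i l
    simp only [lieConn, mpd_congr hG.isOpen hjac hy, hjac y hy, heq y hy, hpd y hy]
  set τ : Fin n → ℝ := fun b => ∑ i, ∑ a, ginv (tensorComp e g.inner) i a y *
    lieConn (tensorComp e g.inner) (sharp (tensorComp e g.inner) (formComp e θ)) i y b a with hτ
  have hsam : ∀ j, sampson (tensorComp e g.inner) (formComp e θ) j y =
      -(Matrix.mulVec (compMat (tensorComp e g.inner) y) τ) j :=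
    fun j => hG.sampson_eq hform hy j
  have hder : ∀ Φ, IsLocalFamily (vecComp e ξ) Φ y → ∀ k,
      HasDerivAt (fun t => tension (tensorComp e g.inner) (Φ t) k y) (τ k) 0 := by
    intro Φ hΦ k
    have := hG.hasDerivAt_tension hy hΦ k
    simpa only [hlie] using this
  constructor
  · intro h j
    have h0 : τ = 0 := by
      funext k
      -- The derivative of the tension depends only on the velocity, so one family suffices to force
      -- `τ = 0`; the straight-line one needs no flow.
      have hΦ := isLocalFamily_add_smul hG.isOpen hvec hy
      exact (hder _ hΦ k).unique (h _ hΦ k)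
    rw [hsam, h0, Matrix.mulVec_zero, Pi.zero_apply, neg_zero]
  · intro h Φ hΦ k
    have h0 : Matrix.mulVec (compMat (tensorComp e g.inner) y) τ = 0 := by
      funext j
      have := h j
      rwa [hsam, neg_eq_zero] at this
    -- Nondegeneracy of `g` undoes the lowering of the index.
    have h1 : τ = 0 := by
      rw [← Matrix.one_mulVec τ, ← hG.inv_mul hy, ← Matrix.mulVec_mulVec, h0, Matrix.mulVec_zero]
    have := hder Φ hΦ k
    rwa [h1] at this

end Components

end YorkRicci

/-! ### The theorem -/

open YorkRicci in
theorem proposition2 {n : ℕ} (hn : 3 ≤ n) {M : Type*} [TopologicalSpace M] [T2Space M]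
    [CompactSpace M] [ChartedSpace (Coord n) M] [IsManifold (𝓡 n) ∞ M]
    (g : YorkRicci.Metric n M) (ξ : VectorField n M) (θ : OneForm n M)
    (hθ : ∀ (x : M) (v : TangentSpace (𝓡 n) x), θ x v = g.inner x (ξ x) v)
    (lam : C^∞⟮𝓡 n, M; ℝ⟯) (φ : TwoTensor n M) (h : IsYorkDecompositionRic g θ lam φ) :
    (∀ e ∈ charts n M, ∀ y ∈ e.target, ∀ i,
      sampson (tensorComp e g.inner) (formComp e θ) i y
        = -((n : ℝ) - 2) * pd i (fun z => lam (e.symm z)) y) ∧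
    (PreconnectedSpace M →
      ((∃ c : ℝ, ∀ x, lam x = c) ↔ IsInfinitesimalHarmonic g ξ)) := by
  have hS : ∀ e ∈ charts n M, ∀ y ∈ e.target, ∀ i,
      sampson (tensorComp e g.inner) (formComp e θ) i y
        = -((n : ℝ) - 2) * pd i (fun z => lam (e.symm z)) y := fun e he y hy i =>
    (isMetricOn_tensorComp he g).sampson_of_york (contDiffOn_formComp he θ)
      (contDiffOn_funComp he lam) (contDiffOn_tensorComp he φ.contMDiff)
      (h.isTT.divergence_eq_zero e he) (h.isTT.trace_eq_zero e he) (h.ricci_eq e he) hy i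
  refine ⟨hS, fun _ => ?_⟩
  rw [isInfinitesimalHarmonic_iff g ξ θ hθ]
  constructor
  · rintro ⟨c, hc⟩ e he y hy i
    rw [hS e he y hy i]
    simp only [hc, pd_const, mul_zero]
  · intro h0
    refine exists_eq_const_of_pd_eq_zero lam fun e he y hy i => ?_
    -- Here `n ≥ 3` enters: the factor `n - 2` can be cancelled.
    have h3 : (3 : ℝ) ≤ n := by exact_mod_cast hn
    have h1 := h0 e he y hy i
    rw [hS e he y hy i] at h1
    exact (mul_eq_zero.1 h1).resolve_left (by linarith)
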